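/- Let $(\Omega,\mathcal A,\mathbb P)$ be a probability space with a filtration $(\mathcal F_t)_{t\ge 0}$, let $T\ge 0$, let $K,g_0\in L^1([0,T])$ be nonnegative, and let $b\le 0\le c$. Let $(U_{0,t})_{t\le T}$ be an adapted, almost surely continuous and non-decreasing process, and let $(Z_{0,t})_{t\le T}$ be an almost surely continuous $(\mathcal F_t)$-martingale with quadratic variation $\langle Z_{0,\cdot}\rangle=U_{0,\cdot}$ (that is, $Z_{0,\cdot}^2-U_{0,\cdot}$ is a local martingale), both starting from $0$, such that for every $t\le T$, almost surely, $$U_{0,t}=\int_0^t g_0(r)\,dr+\int_0^t K(t-r)\,\bigl(bU_{0,r}+cZ_{0,r}\bigr)\,dr .$$ For $0\le s\le t\le T$ write $U_{s,t}=U_{0,t}-U_{0,s}$ and $Z_{s,t}=Z_{0,t}-Z_{0,s}$, and set $$G_s(t)=\int_s^t g_0(u)\,du+\int_0^s\Bigl(\int_s^t K(u-r)\,du\Bigr)\bigl(b\,dU_{0,r}+c\,dZ_{0,r}\bigr),$$ where the $dU$-integral is a pathwise Lebesgue–Stieltjes integral and the $dZ$-integral is an Itô integral. Then, for all $0\le s\le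 t\le T$, both integrals are well defined (the $dU$-integral almost surely, the Itô integral up to null sets), $G_s(t)$ is $\mathcal F_s$-measurable (it agrees almost surely with an $\mathcal F_s$-measurable random variable, and is itself $\mathcal F_s$-measurable if $\mathcal F_s$ contains all $\mathbb P$-null sets), and almost surely the function $r\mapsto K(t-r)(bU_{s,r}+cZ_{s,r})$ is integrable on $[s,t]$ and $$U_{s,t}=G_s(t)+\int_s^t K(t-r)\,\bigl(bU_{s,r}+cZ_{s,r}\bigr)\,dr .$$ -/

import Mathlib

open MeasureTheory ProbabilityTheory Filter Topology
open scoped NNReal ENNReal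

noncomputable section

namespace Volterra

variable {Ω : Type*} {mΩ : MeasurableSpace Ω}

/-- The increment `X_{s,t} = X_t - X_s` of a process. -/
def incr (X : ℝ≥0 → Ω → ℝ) (s t : ℝ≥0) (ω : Ω) : ℝ := X t ω - X s ω

open Classical in
/-- The Lebesgue–Stieltjes measure `dA` on `(0, s]` of a path `A` which is non-decreasing on
`[0, s]` (the path is frozen outside `[0, s]`); by convention `0` for other paths. -/
def stieltjesMeasure (A : ℝ≥0 → ℝ) (s : ℝ≥0) : Measure ℝ :=
  if h : Monotone (fun r : ℝ => A (min r.toNNReal s)) then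
    h.stieltjesFunction.measure.restrict (Set.Ioc 0 (s : ℝ))
  else 0

/-- A bounded simple predictable process `∑_{i < n} ξ_i 1_{(t_i, t_{i+1}]}`, where
`t_0 ≤ t_1 ≤ …` and each `ξ_i` is bounded and `𝓕_{t_i}`-measurable. -/
structure SimplePredictable (𝓕 : Filtration ℝ≥0 mΩ) where
  n : ℕ
  time : ℕ → ℝ≥0
  time_mono : Monotone time
  coeff : ℕ → Ω → ℝ
  coeff_meas : ∀ i, StronglyMeasurable[𝓕 (time i)] (coeff i)
  coeff_bdd : ∃ C : ℝ, ∀ i ω, |coeff i ω| ≤ C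

/-- The value at time `r` of a simple predictable process. -/
def SimplePredictable.eval {𝓕 : Filtration ℝ≥0 mΩ} (S : SimplePredictable 𝓕)
    (r : ℝ) (ω : Ω) : ℝ :=
  ∑ i ∈ Finset.range S.n,
    (Set.Ioc (S.time i : ℝ) (S.time (i + 1) : ℝ)).indicator (fun _ => S.coeff i ω) r

/-- The elementary stochastic integral `∑ ξ_i (Z_{t_{i+1} ∧ s} - Z_{t_i ∧ s})`. -/
def SimplePredictable.integral {𝓕 : Filtration ℝ≥0 mΩ} (S : SimplePredictable 𝓕)
    (Z : ℝ≥0 → Ω → ℝ) (s : ℝ≥0) (ω : Ω) : ℝ :=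
  ∑ i ∈ Finset.range S.n,
    S.coeff i ω * (Z (min (S.time (i + 1)) s) ω - Z (min (S.time i) s) ω)

/-- `I` is (a version of) the Itô integral `∫_0^s H_r dZ_r`, where `A` is the quadratic variation
of the continuous square-integrable martingale `Z`: there are bounded simple predictable processes
`S_n` with `E ∫_0^s |S_n - H|² dA → 0` and `∫_0^s S_n dZ → I` in `L²(P)`. -/
def IsItoIntegral (𝓕 : Filtration ℝ≥0 mΩ) (P : Measure Ω) (Z A : ℝ≥0 → Ω → ℝ)
    (H : ℝ → Ω → ℝ) (s : ℝ≥0) (I : Ω → ℝ) : Prop :=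
  MemLp I 2 P ∧ ∃ S : ℕ → SimplePredictable 𝓕,
    Tendsto (fun n => ∫⁻ ω, ∫⁻ r, ‖(S n).eval r ω - H r ω‖ₑ ^ 2
      ∂(stieltjesMeasure (fun u => A u ω) s) ∂P) atTop (𝓝 0) ∧
    Tendsto (fun n => eLpNorm (fun ω => (S n).integral Z s ω - I ω) 2 P) atTop (𝓝 0)

open Classical in
/-- The Itô integral `∫_0^s H_r dZ_r` (a chosen version; `0` if there is none). -/
def itoIntegral (𝓕 : Filtration ℝ≥0 mΩ) (P : Measure Ω) (Z A : ℝ≥0 → Ω → ℝ)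
    (H : ℝ → Ω → ℝ) (s : ℝ≥0) : Ω → ℝ :=
  if h : ∃ I, IsItoIntegral 𝓕 P Z A H s I then h.choose else 0

/-- `(U, Z)` solves, on the time interval `[0, T]`,
`U_t = ∫_0^t g₀(r) dr + ∫_0^t K(t - r) (b U_r + c Z_r) dr`,
where `U` is a continuous non-decreasing adapted process and `Z` is a continuous martingale with
quadratic variation `U`, both starting from `0`. A process indexed by `[0, T]` is viewed as one on
`[0, ∞)` by freezing it at `T`, which is what `min t T` does below. -/
structure IsSolution (K g₀ : ℝ → ℝ) (b c : ℝ) (T : ℝ≥0) (𝓕 : Filtration ℝ≥0 mΩ)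
    (P : Measure Ω) (U Z : ℝ≥0 → Ω → ℝ) : Prop where
  U_adapted : ∀ t ≤ T, StronglyMeasurable[𝓕 t] (U t)
  U_zero : ∀ᵐ ω ∂P, U 0 ω = 0
  U_mono : ∀ᵐ ω ∂P, MonotoneOn (fun t => U t ω) (Set.Iic T)
  U_cont : ∀ᵐ ω ∂P, ContinuousOn (fun t => U t ω) (Set.Iic T)
  Z_martingale : Martingale (fun t => Z (min t T)) 𝓕 P
  Z_zero : ∀ᵐ ω ∂P, Z 0 ω = 0
  Z_cont : ∀ᵐ ω ∂P, ContinuousOn (fun t => Z t ω) (Set.Iic T)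
  /-- `⟨Z⟩ = U`: the process `Z² - U` is a local martingale. -/
  quadVar : Locally (fun X => Martingale X 𝓕 P) 𝓕
    (fun t ω => Z (min t T) ω ^ 2 - U (min t T) ω) P
  equation : ∀ t ≤ T, ∀ᵐ ω ∂P,
    U t ω = (∫ r in (0 : ℝ)..t, g₀ r) +
      ∫ r in (0 : ℝ)..t, K (t - r) * (b * U r.toNNReal ω + c * Z r.toNNReal ω)

/-- The (deterministic) integrand `r ↦ ∫_s^t K(u - r) du`. -/
def kernelInt (K : ℝ → ℝ) (s t : ℝ≥0) (r : ℝ) : ℝ := ∫ u in (s : ℝ)..t, K (u - r)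

/-- `G_s(t) = ∫_s^t g₀(u) du + ∫_0^s ∫_s^t K(u - r) du (b dU_r + c dZ_r)`. -/
def G (K g₀ : ℝ → ℝ) (b c : ℝ) (𝓕 : Filtration ℝ≥0 mΩ) (P : Measure Ω)
    (U Z : ℝ≥0 → Ω → ℝ) (s t : ℝ≥0) (ω : Ω) : ℝ :=
  (∫ u in (s : ℝ)..t, g₀ u) +
    (b * ∫ r, kernelInt K s t r ∂(stieltjesMeasure (fun u => U u ω) s) +
      c * itoIntegral 𝓕 P Z U (fun r _ => kernelInt K s t r) s ω)

end Volterra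

end

/-! Put `X = bU + cZ` and `H(r) = ∫_s^t K(u - r) du`. Subtracting the equation at `s` from the one
at `t` and splitting the convolution at `s` leaves `∫_s^t g₀`, the wanted integral `∫_s^t K(t -
r)(X_r - X_s) dr`, and the remainder `H(s) X_s - ∫_0^s X_r (K(s - r) - K(t - r)) dr`. Since `H` is
absolutely continuous with derivative `K(s - r) - K(t - r)` and `X_0 = 0`, this remainder is `∫_0^s
H dX` integrated by parts. No stochastic Fubini theorem is needed: everything rests on identifying
the two integrals in `G` with their pathwise by-parts expressions (`IsSolution.G_ae_eq`).

Summation by parts (`tendsto_sum_grid`) shows that the Riemann sums of `H` against any continuous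
path started at `0` converge to the by-parts expression. Against `dU` the same sums converge to the
Stieltjes integral. Against `dZ` they are Itô integrals of step functions converging uniformly to
`H`, so the isometry `isometry_sub` makes their limit the Itô integral and forces every other
approximating sequence to the same limit. Measurability of `G` with respect to `𝓕 s` follows because
the sums only involve times up to `s`.

The isometry requires `Z` to be square integrable and `Z² - U` to be a true martingale. Both follow
from `E U_T < ∞` by localization (`memLp`, `martingale_sq_sub`), and `E U_T < ∞` is read off the
equation at `T`: the term with `bKU` is nonpositive, so `U_T` is at most an integrable functional of
`Z`. -/

noncomputable section

namespace Volterra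

variable {Ω : Type*} {mΩ : MeasurableSpace Ω}

/-! ### Optional stopping for second moments, and Scheffé's lemma -/

/-- A process with almost surely continuous paths agrees, outside a null set, with a jointly
measurable one. -/
lemma exists_stronglyMeasurable_uncurry_version {P : Measure Ω} {X : ℝ≥0 → Ω → ℝ}
    (hX : ∀ t, StronglyMeasurable (X t)) (hc : ∀ᵐ ω ∂P, Continuous fun t => X t ω) :
    ∃ Y : ℝ≥0 → Ω → ℝ, StronglyMeasurable (Function.uncurry Y) ∧
      ∀ᵐ ω ∂P, ∀ t, X t ω = Y t ω := by
  obtain ⟨N, hN, hNm, hN0⟩ := exists_measurable_superset_of_null hc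
  refine ⟨fun t => Nᶜ.indicator (X t), ?_, ?_⟩
  · refine stronglyMeasurable_uncurry_of_continuous_of_stronglyMeasurable (fun ω => ?_)
      (fun t => (hX t).indicator hNm.compl)
    by_cases hω : ω ∈ N
    · simpa [Set.indicator, hω] using continuous_const
    · have : Continuous fun t => X t ω := by
        by_contra h
        exact hω (hN h)
      simpa [Set.indicator, hω] using this
  · have : ∀ᵐ ω ∂P, ω ∉ N := measure_eq_zero_iff_ae_notMem.1 hN0
    filter_upwards [this] with ω hω t
    simp [Set.indicator, hω]

lemma aestronglyMeasurable_comp_time {P : Measure Ω} {X : ℝ≥0 → Ω → ℝ}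
    (hX : ∀ t, StronglyMeasurable (X t)) (hc : ∀ᵐ ω ∂P, Continuous fun t => X t ω)
    {σ : Ω → ℝ≥0} (hσ : Measurable σ) : AEStronglyMeasurable (fun ω => X (σ ω) ω) P := by
  obtain ⟨Y, hY, hXY⟩ := exists_stronglyMeasurable_uncurry_version hX hc
  refine ⟨fun ω => Y (σ ω) ω, hY.comp_measurable (hσ.prodMk measurable_id), ?_⟩
  filter_upwards [hXY] with ω h using h _

/-- Increments of a martingale are orthogonal to the past. -/
lemma integral_mul_martingale_eq {P : Measure Ω} [IsFiniteMeasure P] {𝓕 : Filtration ℝ≥0 mΩ}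
    {M : ℝ≥0 → Ω → ℝ} (hM : Martingale M 𝓕 P) {a b : ℝ≥0} (hab : a ≤ b) {η : Ω → ℝ}
    (hη : StronglyMeasurable[𝓕 a] η) (hint : Integrable (fun ω => η ω * M b ω) P) :
    ∫ ω, η ω * M b ω ∂P = ∫ ω, η ω * M a ω ∂P := by
  have h := condExp_mul_of_stronglyMeasurable_left hη hint (hM.integrable b)
  rw [← integral_condExp (𝓕.le a)]
  refine integral_congr_ae ?_
  filter_upwards [h, hM.condExp_ae_eq hab] with ω h1 h2
  rw [← h2]; exact h1

/-- Conditioning gives `E[1_A M_a M_b] = E[1_A M_a²]`; integrating `2 M_a M_b - M_a² ≤ M_b²` over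
`A` then yields the bound. -/
lemma setLIntegral_sq_martingale_mono {P : Measure Ω} [IsFiniteMeasure P]
    {𝓕 : Filtration ℝ≥0 mΩ} {M : ℝ≥0 → Ω → ℝ} (hM : Martingale M 𝓕 P)
    (hM2 : ∀ t, MemLp (M t) 2 P) {a b : ℝ≥0} (hab : a ≤ b) {A : Set Ω}
    (hA : MeasurableSet[𝓕 a] A) :
    ∫⁻ ω in A, ENNReal.ofReal (M a ω ^ 2) ∂P ≤ ∫⁻ ω in A, ENNReal.ofReal (M b ω ^ 2) ∂P := by
  have hA' := 𝓕.le a A hA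
  rw [← ofReal_integral_eq_lintegral_ofReal (hM2 a).integrable_sq.integrableOn
      (ae_of_all _ fun _ => sq_nonneg _),
    ← ofReal_integral_eq_lintegral_ofReal (hM2 b).integrable_sq.integrableOn
      (ae_of_all _ fun _ => sq_nonneg _)]
  refine ENNReal.ofReal_le_ofReal ?_
  have i1 : Integrable (fun ω => M a ω * M b ω) P := (hM2 a).integrable_mul (hM2 b)
  have i2 : Integrable (fun ω => M a ω * M a ω) P := (hM2 a).integrable_mul (hM2 a)
  have key : ∫ ω in A, M a ω * M b ω ∂P = ∫ ω in A, M a ω * M a ω ∂P := by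
    rw [← integral_indicator hA', ← integral_indicator hA']
    have hmul : ∀ c, (A.indicator fun ω => M a ω * M c ω) =
        fun ω => A.indicator (M a) ω * M c ω := fun c => by
      ext ω; rw [← Set.indicator_mul_left]
    have hi := i1.indicator hA'
    rw [hmul] at hi ⊢
    rw [hmul]
    exact integral_mul_martingale_eq hM hab ((hM.stronglyMeasurable a).indicator hA) hi
  have h1 : ∫ ω in A, (2 * (M a ω * M b ω) - M a ω * M a ω) ∂P ≤ ∫ ω in A, M b ω ^ 2 ∂P :=
    integral_mono (((i1.const_mul 2).sub i2).integrableOn) (hM2 b).integrable_sq.integrableOn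
      fun ω => by
        have := sq_nonneg (M b ω - M a ω)
        simp only
        linarith
  rw [integral_sub (i1.const_mul 2).integrableOn i2.integrableOn, integral_const_mul, key] at h1
  simp only [pow_two] at h1 ⊢
  linarith

lemma tendsto_ceil_mul_div (x : ℝ≥0) :
    Tendsto (fun n : ℕ => (⌈x * (n + 1)⌉₊ : ℝ≥0) / (n + 1)) atTop (𝓝 x) := by
  rw [← NNReal.tendsto_coe]
  have := (tendsto_nat_ceil_mul_div_atTop (R := ℝ) (a := x) x.coe_nonneg).comp
    (tendsto_natCast_atTop_atTop (R := ℝ) |>.comp (tendsto_add_atTop_nat 1))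
  refine this.congr fun n => ?_
  have : ⌈(x : ℝ) * (n + 1)⌉₊ = ⌈x * (n + 1)⌉₊ := by
    refine eq_of_forall_ge_iff fun k => ?_
    rw [Nat.ceil_le, Nat.ceil_le, ← NNReal.coe_le_coe]
    push_cast
    rfl
  simp [this]

/-- Optional stopping for the second moment of a continuous square-integrable martingale. -/
lemma lintegral_sq_martingale_stopped_le {P : Measure Ω} [IsFiniteMeasure P]
    {𝓕 : Filtration ℝ≥0 mΩ} {M : ℝ≥0 → Ω → ℝ} (hM : Martingale M 𝓕 P)
    (hM2 : ∀ t, MemLp (M t) 2 P) (hc : ∀ᵐ ω ∂P, Continuous fun t => M t ω)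
    {u : ℝ≥0} {σ : Ω → ℝ≥0} (hσu : ∀ ω, σ ω ≤ u)
    (hσ : ∀ r, MeasurableSet[𝓕 r] {ω | σ ω ≤ r}) :
    ∫⁻ ω, ENNReal.ofReal (M (σ ω) ω ^ 2) ∂P ≤ ∫⁻ ω, ENNReal.ofReal (M u ω ^ 2) ∂P := by
  have hσm : Measurable σ := measurable_of_Iic fun r => 𝓕.le r _ (hσ r)
  have hMm : ∀ t, StronglyMeasurable (M t) := fun t => (hM.stronglyMeasurable t).mono (𝓕.le t)
  -- Approximate `σ` from above by times on the grid of mesh `1 / (n + 1)`, capped at `u`. Each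
  -- approximation takes countably many values, so second moments can be compared on each event `{g
  -- n = j}`; path continuity and Fatou's lemma then give the limit.
  let g : ℕ → Ω → ℕ := fun n ω => ⌈σ ω * (n + 1)⌉₊
  have hg : ∀ n, Measurable (g n) := fun n => Nat.measurable_ceil.comp (hσm.mul_const _)
  let θ : ℕ → ℕ → ℝ≥0 := fun n j => min ((j : ℝ≥0) / (n + 1)) u
  have hgA : ∀ n j, MeasurableSet[𝓕 (θ n j)] {ω | g n ω ≤ j} := by
    intro n j
    have : {ω | g n ω ≤ j} = {ω | σ ω ≤ θ n j} := by
      ext ω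
      -- The cap at `u` costs nothing here because `σ ≤ u` everywhere.
      simp only [g, θ, Set.mem_ofPred_eq, Nat.ceil_le, le_min_iff, hσu, and_true]
      rw [le_div_iff₀ (by positivity)]
    rw [this]; exact hσ _
  have hgE : ∀ n j, MeasurableSet[𝓕 (θ n j)] {ω | g n ω = j} := by
    intro n j
    rcases j with _ | j
    · simpa using hgA n 0
    · have : {ω | g n ω = j + 1} = {ω | g n ω ≤ j + 1} \ {ω | g n ω ≤ j} := by
        ext ω; simp; omega
      rw [this]
      refine (hgA n (j + 1)).diff (𝓕.mono ?_ _ (hgA n j))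
      refine min_le_min_right _ ?_
      gcongr; simp
  have hstep : ∀ n, ∫⁻ ω, ENNReal.ofReal (M (θ n (g n ω)) ω ^ 2) ∂P
      ≤ ∫⁻ ω, ENNReal.ofReal (M u ω ^ 2) ∂P := by
    intro n
    have hU : (⋃ j, {ω | g n ω = j}) = Set.univ := by ext ω; simp
    have hd : Pairwise (Function.onFun Disjoint fun j => {ω | g n ω = j}) := by
      intro i j hij
      refine Set.disjoint_left.2 fun ω h1 h2 => hij ?_
      simp only [Set.mem_ofPred_eq] at h1 h2
      omega
    have hm : ∀ j, MeasurableSet {ω | g n ω = j} := fun j => 𝓕.le _ _ (hgE n j)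
    rw [← setLIntegral_univ, ← setLIntegral_univ (μ := P) fun ω => ENNReal.ofReal (M u ω ^ 2),
      ← hU, lintegral_iUnion hm hd, lintegral_iUnion hm hd]
    refine ENNReal.tsum_le_tsum fun j => ?_
    refine le_trans (le_of_eq (setLIntegral_congr_fun (hm j) fun ω hω => ?_))
      (setLIntegral_sq_martingale_mono hM hM2 (min_le_right _ _ : θ n j ≤ u) (hgE n j))
    simp only [Set.mem_ofPred_eq] at hω
    simp only [hω, θ]
  have hlim : ∀ᵐ ω ∂P, Tendsto (fun n => ENNReal.ofReal (M (θ n (g n ω)) ω ^ 2)) atTop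
      (𝓝 (ENNReal.ofReal (M (σ ω) ω ^ 2))) := by
    filter_upwards [hc] with ω hω
    have h1 : Tendsto (fun n => θ n (g n ω)) atTop (𝓝 (σ ω)) := by
      have := (tendsto_ceil_mul_div (σ ω)).min (tendsto_const_nhds (x := u))
      rwa [min_eq_left (hσu ω)] at this
    exact (ENNReal.continuous_ofReal.tendsto _).comp (((hω.tendsto _).comp h1).pow 2)
  calc ∫⁻ ω, ENNReal.ofReal (M (σ ω) ω ^ 2) ∂P
      = ∫⁻ ω, liminf (fun n => ENNReal.ofReal (M (θ n (g n ω)) ω ^ 2)) atTop ∂P :=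
        lintegral_congr_ae (hlim.mono fun ω h => h.liminf_eq.symm)
    _ ≤ liminf (fun n => ∫⁻ ω, ENNReal.ofReal (M (θ n (g n ω)) ω ^ 2) ∂P) atTop := by
        refine lintegral_liminf_le' fun n => ?_
        have := aestronglyMeasurable_comp_time (σ := fun ω => θ n (g n ω)) hMm hc
          ((measurable_from_nat (f := θ n)).comp (hg n))
        exact (this.aemeasurable.pow_const 2).ennreal_ofReal
    _ ≤ ∫⁻ ω, ENNReal.ofReal (M u ω ^ 2) ∂P :=
        liminf_le_of_le (by isBoundedDefault) fun b hb => by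
          obtain ⟨n, hn⟩ := hb.exists
          exact hn.trans (hstep n)

/-- Scheffé's lemma in the form used below: nonnegative functions that converge almost everywhere
and do not gain mass converge in `L¹`, hence their integrals over sets converge. -/
lemma tendsto_setIntegral_of_integral_le {P : Measure Ω} {f : Ω → ℝ} {F : ℕ → Ω → ℝ}
    (hf : Integrable f P) (hF : ∀ n, Integrable (F n) P) (hf0 : 0 ≤ᵐ[P] f)
    (hF0 : ∀ n, 0 ≤ᵐ[P] F n)
    (hlim : ∀ᵐ ω ∂P, Tendsto (fun n => F n ω) atTop (𝓝 (f ω)))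
    (hle : ∀ n, ∫ ω, F n ω ∂P ≤ ∫ ω, f ω ∂P) (A : Set Ω) :
    Tendsto (fun n => ∫ ω in A, F n ω ∂P) atTop (𝓝 (∫ ω in A, f ω ∂P)) := by
  have hpos : Tendsto (fun n => ∫ ω, max (f ω - F n ω) 0 ∂P) atTop (𝓝 0) := by
    suffices Tendsto (fun n => ∫ ω, max (f ω - F n ω) 0 ∂P) atTop (𝓝 (∫ _, (0 : ℝ) ∂P)) by
      simpa using this
    refine tendsto_integral_of_dominated_convergence f (fun n => (hf.sub (hF n)).pos_part.1) hf
      (fun n => ?_) ?_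
    · filter_upwards [hf0, hF0 n] with ω h0 h1
      simp only [Pi.zero_apply] at h0 h1
      rw [Real.norm_of_nonneg (le_max_right _ _)]
      exact max_le (by linarith) h0
    · filter_upwards [hlim] with ω h
      have := (tendsto_const_nhds (x := f ω)).sub h |>.max (tendsto_const_nhds (x := (0 : ℝ)))
      simpa using this
  have hL1 : Tendsto (fun n => ∫ ω, ‖F n ω - f ω‖ ∂P) atTop (𝓝 0) := by
    have h2 := hpos.const_mul 2
    rw [mul_zero] at h2
    refine squeeze_zero (fun n => integral_nonneg fun ω => norm_nonneg _) (fun n => ?_) h2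
    -- The positive part is dominated by `f` and tends to zero in mean, while `f - F n` has
    -- nonnegative integral; hence the `L¹` distance is at most twice the integral of the positive
    -- part.
    have : ∀ ω, ‖F n ω - f ω‖ = 2 * max (f ω - F n ω) 0 - (f ω - F n ω) := fun ω => by
      rw [Real.norm_eq_abs]
      rcases le_total (F n ω) (f ω) with h | h
      · rw [abs_of_nonpos (by linarith), max_eq_left (by linarith)]; ring
      · rw [abs_of_nonneg (by linarith), max_eq_right (by linarith)]; ring
    simp_rw [this]
    have hs : Integrable (fun ω => f ω - F n ω) P := hf.sub (hF n)
    rw [integral_sub (hs.pos_part.const_mul 2) hs, integral_const_mul, integral_sub hf (hF n)]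
    linarith [hle n]
  exact tendsto_setIntegral_of_L1' f hf.1 (Eventually.of_forall hF) (by
    have h3 := (ENNReal.continuous_ofReal.tendsto 0).comp hL1
    rw [ENNReal.ofReal_zero] at h3
    refine h3.congr fun n => ?_
    rw [eLpNorm_one_eq_lintegral_enorm, ← ofReal_integral_norm_eq_lintegral_enorm ((hF n).sub hf)]
    rfl) A

/-! ### From integrable quadratic variation to square integrability -/

/-- A continuous martingale `M` together with its integrable quadratic variation `V`. -/
structure IsContMartWithQuadVar (𝓕 : Filtration ℝ≥0 mΩ) (P : Measure Ω)
    (M V : ℝ≥0 → Ω → ℝ) : Prop where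
  martingale : Martingale M 𝓕 P
  cont : ∀ᵐ ω ∂P, Continuous fun t => M t ω
  zero : ∀ᵐ ω ∂P, M 0 ω = 0
  V_adapted : ∀ t, StronglyMeasurable[𝓕 t] (V t)
  V_cont : ∀ᵐ ω ∂P, Continuous fun t => V t ω
  V_mono : ∀ᵐ ω ∂P, Monotone fun t => V t ω
  V_zero : ∀ᵐ ω ∂P, V 0 ω = 0
  V_integrable : ∀ t, Integrable (V t) P
  quadVar : Locally (fun X => Martingale X 𝓕 P) 𝓕 (fun t ω => M t ω ^ 2 - V t ω) P

namespace IsContMartWithQuadVar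

variable {𝓕 : Filtration ℝ≥0 mΩ} {P : Measure Ω} {M V : ℝ≥0 → Ω → ℝ}

/-- A localizing sequence truncated at deterministic times. -/
lemma exists_localizing_times (h : IsContMartWithQuadVar 𝓕 P M V) :
    ∃ σ : ℕ → ℝ≥0 → Ω → ℝ≥0, (∀ n t ω, σ n t ω ≤ t) ∧
      (∀ n t r, MeasurableSet[𝓕 r] {ω | σ n t ω ≤ r}) ∧
      (∀ t, ∀ᵐ ω ∂P, ∀ᶠ n in atTop, σ n t ω = t) ∧
      ∀ n, ∃ Y, Martingale Y 𝓕 P ∧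
        ∀ t, Y t =ᵐ[P] fun ω => M (σ n t ω) ω ^ 2 - V (σ n t ω) ω := by
  obtain ⟨τ, hτ, hY⟩ := h.quadVar
  have hcoe : ∀ n (t : ℝ≥0) ω, (((min (t : WithTop ℝ≥0) (τ n ω)).untopA : ℝ≥0) : WithTop ℝ≥0)
      = min (t : WithTop ℝ≥0) (τ n ω) := fun n t ω => by
    rw [WithTop.untopA_eq_untop
      (ne_of_lt ((min_le_left _ _).trans_lt (WithTop.coe_lt_top t))), WithTop.coe_untop]
  refine ⟨fun n t ω => (min (t : WithTop ℝ≥0) (τ n ω)).untopA, ?_, ?_, ?_, fun n => ⟨_, hY n, ?_⟩⟩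
  · intro n t ω
    rw [← WithTop.coe_le_coe, hcoe]
    exact min_le_left _ _
  · intro n t r
    have : {ω | (min (t : WithTop ℝ≥0) (τ n ω)).untopA ≤ r} = {ω | t ≤ r} ∪ {ω | τ n ω ≤ r} := by
      ext ω
      simp only [Set.mem_ofPred_eq, Set.mem_union]
      rw [← WithTop.coe_le_coe, hcoe, min_le_iff, WithTop.coe_le_coe]
    rw [this]
    exact (MeasurableSet.const _).union (hτ.isStoppingTime n r)
  · intro t
    filter_upwards [hτ.tendsto_top] with ω hω
    filter_upwards [hω.eventually (lt_mem_nhds (WithTop.coe_lt_top t))] with n hn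
    rw [← WithTop.coe_inj, hcoe, min_eq_left hn.le]
  · intro t
    filter_upwards [h.zero, h.V_zero] with ω h0 h1
    -- `Locally` sets the stopped process to zero where `τ n = ⊥`. There the truncated time is `0`,
    -- and `M² - V` vanishes at `0` almost surely, so the two agree.
    by_cases hb : ⊥ < τ n ω
    · simp only [stoppedProcess, Set.indicator, Set.mem_ofPred_eq, hb, if_true]
    · have hb' : τ n ω = ⊥ := not_bot_lt_iff.1 hb
      have : (min (t : WithTop ℝ≥0) (τ n ω)).untopA = 0 := by
        rw [← WithTop.coe_inj, hcoe, hb', min_eq_right bot_le]; rfl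
      simp only [stoppedProcess, this, Set.indicator, Set.mem_ofPred_eq, hb, if_false, h0, h1]
      simp

lemma stronglyMeasurable (h : IsContMartWithQuadVar 𝓕 P M V) (t : ℝ≥0) :
    StronglyMeasurable (M t) := (h.martingale.stronglyMeasurable t).mono (𝓕.le t)

lemma V_stronglyMeasurable (h : IsContMartWithQuadVar 𝓕 P M V) (t : ℝ≥0) :
    StronglyMeasurable (V t) := (h.V_adapted t).mono (𝓕.le t)

lemma ae_V_mem (h : IsContMartWithQuadVar 𝓕 P M V) {t : ℝ≥0} {σ : Ω → ℝ≥0}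
    (hσ : ∀ ω, σ ω ≤ t) : ∀ᵐ ω ∂P, 0 ≤ V (σ ω) ω ∧ V (σ ω) ω ≤ V t ω := by
  filter_upwards [h.V_mono, h.V_zero] with ω h1 h2
  exact ⟨h2 ▸ h1 (zero_le (a := σ ω)), h1 (hσ ω)⟩

lemma integrable_V_comp (h : IsContMartWithQuadVar 𝓕 P M V) {t : ℝ≥0} {σ : Ω → ℝ≥0}
    (hσ : ∀ ω, σ ω ≤ t) (hm : Measurable σ) : Integrable (fun ω => V (σ ω) ω) P := by
  refine (h.V_integrable t).mono'
    (aestronglyMeasurable_comp_time h.V_stronglyMeasurable h.V_cont hm) ?_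
  filter_upwards [h.ae_V_mem hσ] with ω hω
  rw [Real.norm_of_nonneg hω.1]; exact hω.2

lemma tendsto_setIntegral_V (h : IsContMartWithQuadVar 𝓕 P M V) {t : ℝ≥0} {σ : ℕ → Ω → ℝ≥0}
    (hσ : ∀ n ω, σ n ω ≤ t) (hm : ∀ n, Measurable (σ n))
    (hev : ∀ᵐ ω ∂P, ∀ᶠ n in atTop, σ n ω = t) (A : Set Ω) :
    Tendsto (fun n => ∫ ω in A, V (σ n ω) ω ∂P) atTop (𝓝 (∫ ω in A, V t ω ∂P)) := by
  refine tendsto_integral_of_dominated_convergence (V t)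
    (fun n => (h.integrable_V_comp (hσ n) (hm n)).1.restrict) (h.V_integrable t).integrableOn
    (fun n => ae_restrict_of_ae ?_) (ae_restrict_of_ae ?_)
  · filter_upwards [h.ae_V_mem (hσ n)] with ω hω
    rw [Real.norm_of_nonneg hω.1]; exact hω.2
  · filter_upwards [hev] with ω hω
    exact tendsto_const_nhds.congr' (hω.mono fun n hn => by simp [hn])

lemma integrable_sq_comp (h : IsContMartWithQuadVar 𝓕 P M V) {t : ℝ≥0} {σ : Ω → ℝ≥0}
    (hσ : ∀ ω, σ ω ≤ t) (hm : Measurable σ) {Y : ℝ≥0 → Ω → ℝ} (hY : Martingale Y 𝓕 P)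
    (hYe : Y t =ᵐ[P] fun ω => M (σ ω) ω ^ 2 - V (σ ω) ω) :
    Integrable (fun ω => M (σ ω) ω ^ 2) P := by
  refine ((hY.integrable t).add (h.integrable_V_comp hσ hm)).congr ?_
  filter_upwards [hYe] with ω hω
  simp [hω]

variable [IsProbabilityMeasure P]

/-- A continuous local martingale whose quadratic variation is integrable is bounded in `L²`. -/
lemma memLp (h : IsContMartWithQuadVar 𝓕 P M V) (t : ℝ≥0) : MemLp (M t) 2 P := by
  obtain ⟨σ, hσt, hσm, hev, hY⟩ := h.exists_localizing_times
  have hm : ∀ n t, Measurable (σ n t) := fun n t =>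
    measurable_of_Iic fun r => 𝓕.le r _ (hσm n t r)
  -- The stopped process `Y` is a martingale starting from `0`, so `E M_σ² = E V_σ ≤ E V_t`
  -- uniformly in `n`; Fatou's lemma carries the bound to `M t`.
  have hle : ∀ n, ∫⁻ ω, ENNReal.ofReal (M (σ n t ω) ω ^ 2) ∂P
      ≤ ENNReal.ofReal (∫ ω, V t ω ∂P) := by
    intro n
    obtain ⟨Y, hYm, hYe⟩ := hY n
    have hi := h.integrable_sq_comp (hσt n t) (hm n t) hYm (hYe t)
    have hiV := h.integrable_V_comp (hσt n t) (hm n t)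
    rw [← ofReal_integral_eq_lintegral_ofReal hi (ae_of_all _ fun _ => sq_nonneg _)]
    refine ENNReal.ofReal_le_ofReal ?_
    have h0 : ∫ ω, Y t ω ∂P = 0 := by
      have h1 := hYm.setIntegral_eq (zero_le (a := t)) MeasurableSet.univ
      rw [setIntegral_univ, setIntegral_univ] at h1
      rw [← h1, integral_congr_ae (hYe 0), ← integral_zero Ω ℝ (μ := P)]
      refine integral_congr_ae ?_
      filter_upwards [h.zero, h.V_zero] with ω h2 h3
      have : σ n 0 ω = 0 := le_antisymm (hσt n 0 ω) (zero_le)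
      simp [this, h2, h3]
    rw [integral_congr_ae (hYe t), integral_sub hi hiV] at h0
    have h4 : ∫ ω, V (σ n t ω) ω ∂P ≤ ∫ ω, V t ω ∂P :=
      integral_mono_ae hiV (h.V_integrable t) ((h.ae_V_mem (hσt n t)).mono fun ω hω => hω.2)
    linarith
  rw [memLp_two_iff_integrable_sq (h.stronglyMeasurable t).aestronglyMeasurable]
  refine ⟨((h.stronglyMeasurable t).pow 2).aestronglyMeasurable, ?_⟩
  rw [hasFiniteIntegral_iff_ofReal (ae_of_all _ fun _ => sq_nonneg _)]
  refine lt_of_le_of_lt ?_ (ENNReal.ofReal_lt_top (r := ∫ ω, V t ω ∂P))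
  calc ∫⁻ ω, ENNReal.ofReal (M t ω ^ 2) ∂P
      = ∫⁻ ω, liminf (fun n => ENNReal.ofReal (M (σ n t ω) ω ^ 2)) atTop ∂P := by
        refine lintegral_congr_ae ?_
        filter_upwards [hev t] with ω hω
        refine (Tendsto.liminf_eq ?_).symm
        exact tendsto_const_nhds.congr' (hω.mono fun n hn => by simp [hn])
    _ ≤ liminf (fun n => ∫⁻ ω, ENNReal.ofReal (M (σ n t ω) ω ^ 2) ∂P) atTop := by
        refine lintegral_liminf_le' fun n => ?_
        have := aestronglyMeasurable_comp_time h.stronglyMeasurable h.cont (hm n t)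
        exact (this.aemeasurable.pow_const 2).ennreal_ofReal
    _ ≤ ENNReal.ofReal (∫ ω, V t ω ∂P) :=
        liminf_le_of_le (by isBoundedDefault) fun b hb => by
          obtain ⟨n, hn⟩ := hb.exists
          exact hn.trans (hle n)

/-- The local martingale `M² - V` is a martingale. -/
lemma martingale_sq_sub (h : IsContMartWithQuadVar 𝓕 P M V) :
    Martingale (fun t ω => M t ω ^ 2 - V t ω) 𝓕 P := by
  obtain ⟨σ, hσt, hσm, hev, hY⟩ := h.exists_localizing_times
  have hm : ∀ n t, Measurable (σ n t) := fun n t =>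
    measurable_of_Iic fun r => 𝓕.le r _ (hσm n t r)
  choose Y hYm hYe using hY
  have hint : ∀ t, Integrable (fun ω => M t ω ^ 2 - V t ω) P := fun t =>
    (h.memLp t).integrable_sq.sub (h.V_integrable t)
  -- The stopped `V` converges by domination. The stopped `M²` converges by Scheffé's lemma, since
  -- optional stopping bounds its mean by that of the limit. The martingale identity of each `Y n`
  -- thus survives on every set of the past.
  have hlim : ∀ t (A : Set Ω), Tendsto (fun n => ∫ ω in A, Y n t ω ∂P) atTop
      (𝓝 (∫ ω in A, (M t ω ^ 2 - V t ω) ∂P)) := by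
    intro t A
    have hi := fun n => h.integrable_sq_comp (hσt n t) (hm n t) (hYm n) (hYe n t)
    rw [integral_sub (h.memLp t).integrable_sq.integrableOn (h.V_integrable t).integrableOn]
    have h1 : Tendsto (fun n => ∫ ω in A, M (σ n t ω) ω ^ 2 ∂P) atTop
        (𝓝 (∫ ω in A, M t ω ^ 2 ∂P)) := by
      refine tendsto_setIntegral_of_integral_le (h.memLp t).integrable_sq hi
        (ae_of_all _ fun _ => sq_nonneg _) (fun n => ae_of_all _ fun _ => sq_nonneg _) ?_ ?_ A
      · filter_upwards [hev t] with ω hω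
        exact tendsto_const_nhds.congr' (hω.mono fun n hn => by simp [hn])
      · intro n
        have := lintegral_sq_martingale_stopped_le h.martingale h.memLp h.cont (hσt n t) (hσm n t)
        rwa [← ofReal_integral_eq_lintegral_ofReal (hi n) (ae_of_all _ fun _ => sq_nonneg _),
          ← ofReal_integral_eq_lintegral_ofReal (h.memLp t).integrable_sq
            (ae_of_all _ fun _ => sq_nonneg _), ENNReal.ofReal_le_ofReal_iff
            (integral_nonneg fun _ => sq_nonneg _)] at this
    refine (h1.sub (h.tendsto_setIntegral_V (fun n => hσt n t) (fun n => hm n t) (hev t) A)).congr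
      fun n => ?_
    rw [← integral_sub (hi n).integrableOn
      (h.integrable_V_comp (hσt n t) (hm n t)).integrableOn]
    exact (integral_congr_ae (ae_restrict_of_ae (hYe n t))).symm
  have had : ∀ t, StronglyMeasurable[𝓕 t] fun ω => M t ω ^ 2 - V t ω := fun t =>
    ((h.martingale.stronglyMeasurable t).pow 2).sub (h.V_adapted t)
  refine ⟨had, fun a b hab => ?_⟩
  refine (ae_eq_condExp_of_forall_setIntegral_eq (𝓕.le a) (hint b)
    (fun _ _ _ => (hint a).integrableOn) (fun A hA _ => ?_)
    (had a).aestronglyMeasurable).symm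
  refine tendsto_nhds_unique (hlim a A) ((hlim b A).congr fun n => ?_)
  exact ((hYm n).setIntegral_eq hab hA).symm

end IsContMartWithQuadVar

/-! ### Stieltjes measures and covariances of martingale increments -/

lemma stieltjesMeasure_congr {A B : ℝ≥0 → ℝ} {s : ℝ≥0} (h : ∀ r ≤ s, A r = B r) :
    stieltjesMeasure A s = stieltjesMeasure B s := by
  have : (fun r : ℝ => A (min r.toNNReal s)) = fun r : ℝ => B (min r.toNNReal s) := by
    ext r; exact h _ (min_le_right _ _)
  unfold stieltjesMeasure
  by_cases hm : Monotone (fun r : ℝ => B (min r.toNNReal s))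
  · have hm' : Monotone (fun r : ℝ => A (min r.toNNReal s)) := this ▸ hm
    rw [dif_pos hm, dif_pos hm']
    have : hm'.stieltjesFunction = hm.stieltjesFunction := by
      ext x
      rw [hm.stieltjesFunction_eq, hm'.stieltjesFunction_eq, this]
    rw [this]
  · have hm' : ¬ Monotone (fun r : ℝ => A (min r.toNNReal s)) := this ▸ hm
    rw [dif_neg hm, dif_neg hm']

lemma stieltjesMeasure_Ioc {A : ℝ≥0 → ℝ} (hA : Monotone A) (hc : Continuous A) (s a b : ℝ≥0) :
    stieltjesMeasure A s (Set.Ioc (a : ℝ) b) =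
      ENNReal.ofReal (A (min b s) - A (min a s)) := by
  have hm : Monotone (fun r : ℝ => A (min r.toNNReal s)) := fun x y hxy =>
    hA (min_le_min_right _ (Real.toNNReal_le_toNNReal hxy))
  have hcont : Continuous (fun r : ℝ => A (min r.toNNReal s)) :=
    hc.comp (continuous_real_toNNReal.min continuous_const)
  have hset : Set.Ioc (a : ℝ) b ∩ Set.Ioc 0 (s : ℝ) =
      Set.Ioc ((min a s : ℝ≥0) : ℝ) (min b s : ℝ≥0) := by
    ext x
    simp only [Set.mem_inter_iff, Set.mem_Ioc, NNReal.coe_min, min_lt_iff, le_min_iff]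
    have := a.coe_nonneg
    constructor
    · rintro ⟨⟨h1, h2⟩, h3, h4⟩
      exact ⟨Or.inl h1, h2, h4⟩
    · rintro ⟨h1 | h1, h2, h3⟩
      · exact ⟨⟨h1, h2⟩, by linarith, h3⟩
      · linarith
  unfold stieltjesMeasure
  rw [dif_pos hm, Measure.restrict_apply measurableSet_Ioc, hset, StieltjesFunction.measure_Ioc,
    hm.stieltjesFunction_eq, hm.stieltjesFunction_eq, hcont.continuousWithinAt.rightLim_eq,
    hcont.continuousWithinAt.rightLim_eq]
  simp only [Real.toNNReal_coe, min_assoc, min_self]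

lemma ae_stieltjesMeasure_mem (A : ℝ≥0 → ℝ) (s : ℝ≥0) :
    ∀ᵐ r ∂(stieltjesMeasure A s), r ∈ Set.Ioc (0 : ℝ) s := by
  unfold stieltjesMeasure
  split_ifs
  · exact ae_restrict_mem measurableSet_Ioc
  · simp

lemma stieltjesMeasure_univ {A : ℝ≥0 → ℝ} (hA : Monotone A) (hc : Continuous A) (s : ℝ≥0) :
    stieltjesMeasure A s Set.univ = ENNReal.ofReal (A s - A 0) := by
  have := stieltjesMeasure_Ioc hA hc s 0 s
  rw [min_self, min_eq_left (zero_le (a := s))] at this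
  rw [← this, NNReal.coe_zero]
  refine measure_congr ?_
  filter_upwards [ae_stieltjesMeasure_mem A s] with r hr
  exact propext ⟨fun _ => hr, fun _ => Set.mem_univ r⟩

lemma stieltjesMeasure_real_Ioc {A : ℝ≥0 → ℝ} (hA : Monotone A) (hc : Continuous A)
    (s : ℝ≥0) {a b : ℝ≥0} (hab : a ≤ b) :
    (stieltjesMeasure A s).real (Set.Ioc (a : ℝ) b) = A (min b s) - A (min a s) := by
  rw [measureReal_def, stieltjesMeasure_Ioc hA hc, ENNReal.toReal_ofReal]
  exact sub_nonneg.2 (hA (min_le_min_right _ hab))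

lemma isFiniteMeasure_stieltjesMeasure {A : ℝ≥0 → ℝ} (hA : Monotone A) (hc : Continuous A)
    (s : ℝ≥0) : IsFiniteMeasure (stieltjesMeasure A s) :=
  ⟨by rw [stieltjesMeasure_univ hA hc]; exact ENNReal.ofReal_lt_top⟩

lemma memLp_two_mul_of_bdd {P : Measure Ω} {η f : Ω → ℝ} {C : ℝ} (hη : StronglyMeasurable η)
    (hC : ∀ ω, |η ω| ≤ C) (hf : MemLp f 2 P) : MemLp (fun ω => η ω * f ω) 2 P := by
  refine hf.of_le_mul (c := C) (hη.aestronglyMeasurable.mul hf.1) (ae_of_all _ fun ω => ?_)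
  rw [norm_mul]
  exact mul_le_mul_of_nonneg_right (hC ω) (norm_nonneg _)

lemma integrable_mul_of_bdd {P : Measure Ω} {η f : Ω → ℝ} {C : ℝ} (hη : StronglyMeasurable η)
    (hC : ∀ ω, |η ω| ≤ C) (hf : Integrable f P) : Integrable (fun ω => η ω * f ω) P :=
  hf.bdd_mul hη.aestronglyMeasurable (ae_of_all _ hC)

namespace IsContMartWithQuadVar

variable {𝓕 : Filtration ℝ≥0 mΩ} {P : Measure Ω} [IsProbabilityMeasure P] {M V : ℝ≥0 → Ω → ℝ}

lemma integral_mul_incr_eq_zero (h : IsContMartWithQuadVar 𝓕 P M V) {a b : ℝ≥0} (hab : a ≤ b)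
    {η : Ω → ℝ} (hη : StronglyMeasurable[𝓕 a] η) (hη2 : MemLp η 2 P) :
    ∫ ω, η ω * (M b ω - M a ω) ∂P = 0 := by
  have i : ∀ t, Integrable (fun ω => η ω * M t ω) P := fun t => hη2.integrable_mul (h.memLp t)
  simp_rw [mul_sub]
  rw [integral_sub (i b) (i a), integral_mul_martingale_eq h.martingale hab hη (i b), sub_self]

/-- With `N = M² - V`, one has `(M_b - M_a)² = (N_b - N_a) - 2 M_a (M_b - M_a) + (V_b - V_a)`. The
first two terms are orthogonal to the bounded `𝓕 a`-measurable weight `η`. -/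
lemma integral_mul_sq_incr (h : IsContMartWithQuadVar 𝓕 P M V) {a b : ℝ≥0} (hab : a ≤ b)
    {η : Ω → ℝ} {C : ℝ} (hη : StronglyMeasurable[𝓕 a] η) (hC : ∀ ω, |η ω| ≤ C) :
    ∫ ω, η ω * (M b ω - M a ω) ^ 2 ∂P = ∫ ω, η ω * (V b ω - V a ω) ∂P := by
  have hη' := hη.mono (𝓕.le a)
  have hN := h.martingale_sq_sub
  have iN : ∀ t, Integrable (fun ω => η ω * (M t ω ^ 2 - V t ω)) P := fun t =>
    integrable_mul_of_bdd hη' hC (hN.integrable t)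
  have iV : Integrable (fun ω => η ω * (V b ω - V a ω)) P :=
    integrable_mul_of_bdd hη' hC ((h.V_integrable b).sub (h.V_integrable a))
  have hηM := memLp_two_mul_of_bdd hη' hC (h.memLp a)
  have iC : Integrable (fun ω => η ω * M a ω * (M b ω - M a ω)) P :=
    hηM.integrable_mul ((h.memLp b).sub (h.memLp a))
  have h0 := h.integral_mul_incr_eq_zero hab (hη.mul (h.martingale.stronglyMeasurable a)) hηM
  simp only [Pi.mul_apply] at h0
  have h1 := integral_mul_martingale_eq hN hab hη (iN b)
  have : ∀ ω, η ω * (M b ω - M a ω) ^ 2 = (η ω * (M b ω ^ 2 - V b ω) -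
      η ω * (M a ω ^ 2 - V a ω)) - 2 * (η ω * M a ω * (M b ω - M a ω))
      + η ω * (V b ω - V a ω) := fun ω => by ring
  simp_rw [this]
  have iD : Integrable (fun ω => η ω * (M b ω ^ 2 - V b ω) - η ω * (M a ω ^ 2 - V a ω)) P :=
    (iN b).sub (iN a)
  have iE : Integrable (fun ω => (η ω * (M b ω ^ 2 - V b ω) - η ω * (M a ω ^ 2 - V a ω)) -
      2 * (η ω * M a ω * (M b ω - M a ω))) P := iD.sub (iC.const_mul 2)
  rw [integral_add iE iV, integral_sub iD (iC.const_mul 2), integral_sub (iN b) (iN a),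
    integral_const_mul, h0, h1]
  ring

lemma integral_mul_incr_mul_incr_of_le (h : IsContMartWithQuadVar 𝓕 P M V) {a u v : ℝ≥0}
    (hau : a ≤ u) (huv : u ≤ v) {η : Ω → ℝ} {C : ℝ} (hη : StronglyMeasurable[𝓕 a] η)
    (hC : ∀ ω, |η ω| ≤ C) :
    ∫ ω, η ω * ((M u ω - M a ω) * (M v ω - M a ω)) ∂P = ∫ ω, η ω * (V u ω - V a ω) ∂P := by
  have hη' := hη.mono (𝓕.le a)
  have hL := memLp_two_mul_of_bdd hη' hC ((h.memLp u).sub (h.memLp a))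
  have h0 := h.integral_mul_incr_eq_zero huv ((hη.mono (𝓕.mono hau)).mul
    ((h.martingale.stronglyMeasurable u).sub
      ((h.martingale.stronglyMeasurable a).mono (𝓕.mono hau)))) hL
  simp only [Pi.mul_apply, Pi.sub_apply] at h0
  rw [← h.integral_mul_sq_incr hau hη hC, ← add_zero (∫ ω, η ω * (M u ω - M a ω) ^ 2 ∂P), ← h0,
    ← integral_add]
  · exact integral_congr_ae (ae_of_all _ fun ω => by ring)
  · exact integrable_mul_of_bdd hη' hC ((h.memLp u).sub (h.memLp a)).integrable_sq
  · exact hL.integrable_mul ((h.memLp v).sub (h.memLp u))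

/-- Only the part of `(a, b]` after `a'` correlates with `M_{b'} - M_{a'}`. The `max` with `a'`
makes the overlap degenerate, and both sides zero, when `b ≤ a'`. -/
lemma integral_mul_incr_mul_incr (h : IsContMartWithQuadVar 𝓕 P M V) {a b a' b' : ℝ≥0}
    (haa : a ≤ a') (hab' : a' ≤ b') {η : Ω → ℝ} {C : ℝ}
    (hη : StronglyMeasurable[𝓕 a'] η) (hC : ∀ ω, |η ω| ≤ C) :
    ∫ ω, η ω * ((M b ω - M a ω) * (M b' ω - M a' ω)) ∂P =
      ∫ ω, η ω * (V (max a' (min b b')) ω - V a' ω) ∂P := by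
  have hη' := hη.mono (𝓕.le a')
  have hs : ∀ {t}, t ≤ a' → StronglyMeasurable[𝓕 a'] (M t) := fun ht =>
    (h.martingale.stronglyMeasurable _).mono (𝓕.mono ht)
  have hzero : ∀ {u}, u ≤ a' →
      ∫ ω, η ω * (M u ω - M a ω) * (M b' ω - M a' ω) ∂P = 0 := fun {u} hu =>
    h.integral_mul_incr_eq_zero hab' (hη.mul ((hs hu).sub (hs haa)))
      (memLp_two_mul_of_bdd hη' hC ((h.memLp u).sub (h.memLp a)))
  rcases le_total b a' with hb | hb
  · rw [max_eq_left ((min_le_left _ _).trans hb)]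
    simpa [mul_assoc] using hzero hb
  · rw [max_eq_right (le_min hb hab')]
    have key : ∫ ω, η ω * ((M b ω - M a' ω) * (M b' ω - M a' ω)) ∂P =
        ∫ ω, η ω * (V (min b b') ω - V a' ω) ∂P := by
      rcases le_total b b' with hbb | hbb
      · rw [min_eq_left hbb]
        exact h.integral_mul_incr_mul_incr_of_le hb hbb hη hC
      · rw [min_eq_right hbb, ← h.integral_mul_incr_mul_incr_of_le hab' hbb hη hC]
        exact integral_congr_ae (ae_of_all _ fun ω => by ring)
    rw [← key, ← add_zero (∫ ω, η ω * ((M b ω - M a' ω) * (M b' ω - M a' ω)) ∂P),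
      ← hzero le_rfl, ← integral_add]
    · exact integral_congr_ae (ae_of_all _ fun ω => by ring)
    · exact integrable_mul_of_bdd hη' hC
        (((h.memLp b).sub (h.memLp a')).integrable_mul ((h.memLp b').sub (h.memLp a')))
    · exact (memLp_two_mul_of_bdd hη' hC ((h.memLp a').sub (h.memLp a))).integrable_mul
        ((h.memLp b').sub (h.memLp a'))

/-- Expressing the covariance through the intersection makes it symmetric in the two intervals. This
permits ordering the left endpoints, and matches the double sum obtained by squaring a step
function. -/
lemma integral_mul_incr_mul_incr_eq_measure (h : IsContMartWithQuadVar 𝓕 P M V) {s a b a' b' : ℝ≥0}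
    (hab : a ≤ b) (hab' : a' ≤ b') (hb : b ≤ s) (hb' : b' ≤ s) {ξ ξ' : Ω → ℝ} {C C' : ℝ}
    (hξ : StronglyMeasurable[𝓕 a] ξ) (hξ' : StronglyMeasurable[𝓕 a'] ξ')
    (hC : ∀ ω, |ξ ω| ≤ C) (hC' : ∀ ω, |ξ' ω| ≤ C') :
    Integrable (fun ω => ξ ω * ξ' ω * (stieltjesMeasure (fun u => V u ω) s).real
        (Set.Ioc (a : ℝ) b ∩ Set.Ioc (a' : ℝ) b')) P ∧
    ∫ ω, ξ ω * ξ' ω * ((M b ω - M a ω) * (M b' ω - M a' ω)) ∂P =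
      ∫ ω, ξ ω * ξ' ω * (stieltjesMeasure (fun u => V u ω) s).real
        (Set.Ioc (a : ℝ) b ∩ Set.Ioc (a' : ℝ) b') ∂P := by
  wlog haa : a ≤ a' generalizing a b a' b' ξ ξ' C C'
  · have := this hab' hab hb' hb hξ' hξ hC' hC (le_of_not_ge haa)
    simp_rw [mul_comm (ξ _) (ξ' _), mul_comm (M b _ - _), Set.inter_comm (Set.Ioc (a : ℝ) b)]
    exact this
  have hη : StronglyMeasurable[𝓕 a'] (fun ω => ξ ω * ξ' ω) := (hξ.mono (𝓕.mono haa)).mul hξ'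
  have hηC : ∀ ω, |ξ ω * ξ' ω| ≤ C * C' := fun ω => by
    rw [abs_mul]
    exact mul_le_mul (hC ω) (hC' ω) (abs_nonneg _) ((abs_nonneg _).trans (hC ω))
  suffices hae : (fun ω => ξ ω * ξ' ω * (V (max a' (min b b')) ω - V a' ω)) =ᵐ[P]
      fun ω => ξ ω * ξ' ω * (stieltjesMeasure (fun u => V u ω) s).real
        (Set.Ioc (a : ℝ) b ∩ Set.Ioc (a' : ℝ) b') from
    ⟨(integrable_mul_of_bdd (hη.mono (𝓕.le a')) hηC
      ((h.V_integrable _).sub (h.V_integrable _))).congr hae,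
      (h.integral_mul_incr_mul_incr haa hab' hη hηC).trans (integral_congr_ae hae)⟩
  filter_upwards [h.V_cont, h.V_mono] with ω hc hm
  have hset : Set.Ioc (a : ℝ) b ∩ Set.Ioc (a' : ℝ) b' =
      Set.Ioc (a' : ℝ) (max a' (min b b') : ℝ≥0) := by
    have haa' : (a : ℝ) ≤ a' := by exact_mod_cast haa
    ext x
    simp only [Set.mem_inter_iff, Set.mem_Ioc, NNReal.coe_max, NNReal.coe_min, le_max_iff,
      le_min_iff]
    constructor
    · rintro ⟨⟨h1, h2⟩, h3, h4⟩
      exact ⟨h3, Or.inr ⟨h2, h4⟩⟩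
    · rintro ⟨h1, h2 | h2⟩
      · linarith
      · exact ⟨⟨by linarith, h2.1⟩, h1, h2.2⟩
  rw [hset, stieltjesMeasure_real_Ioc hm hc s (le_max_left _ _),
    min_eq_left (max_le (hab'.trans hb') ((min_le_left _ _).trans hb)),
    min_eq_left (hab'.trans hb')]

end IsContMartWithQuadVar

/-! ### The Itô isometry -/

lemma enorm_sq_eq_ofReal_sq (x : ℝ) : ‖x‖ₑ ^ 2 = ENNReal.ofReal (x ^ 2) := by
  rw [← ofReal_norm, ← ENNReal.ofReal_pow (norm_nonneg _), Real.norm_eq_abs, sq_abs]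

lemma integrable_and_integral_sq_sum_indicator {ι : Type*} [Fintype ι] (μ : Measure ℝ)
    [IsFiniteMeasure μ] {s : ι → Set ℝ} (hs : ∀ i, MeasurableSet (s i)) (x : ι → ℝ) :
    Integrable (fun r => (∑ i, (s i).indicator (fun _ => x i) r) ^ 2) μ ∧
    ∫ r, (∑ i, (s i).indicator (fun _ => x i) r) ^ 2 ∂μ =
      ∑ i, ∑ j, x i * x j * μ.real (s i ∩ s j) := by
  have hpt : ∀ r, (∑ i, (s i).indicator (fun _ => x i) r) ^ 2 =
      ∑ i, ∑ j, (s i ∩ s j).indicator (fun _ => x i * x j) r := fun r => by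
    rw [pow_two, Finset.sum_mul_sum]
    refine Finset.sum_congr rfl fun i _ => Finset.sum_congr rfl fun j _ => ?_
    by_cases h1 : r ∈ s i <;> by_cases h2 : r ∈ s j <;> simp [h1, h2]
  have hint : ∀ i j, Integrable ((s i ∩ s j).indicator fun _ => x i * x j) μ := fun i j =>
    (integrable_const _).indicator ((hs i).inter (hs j))
  simp_rw [hpt]
  refine ⟨integrable_finsetSum _ fun i _ => integrable_finsetSum _ fun j _ => hint i j, ?_⟩
  rw [integral_finsetSum _ fun i _ => integrable_finsetSum _ fun j _ => hint i j]
  refine Finset.sum_congr rfl fun i _ => ?_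
  rw [integral_finsetSum _ fun j _ => hint i j]
  refine Finset.sum_congr rfl fun j _ => ?_
  rw [integral_indicator_const _ ((hs i).inter (hs j)), smul_eq_mul, mul_comm]

namespace IsContMartWithQuadVar

variable {𝓕 : Filtration ℝ≥0 mΩ} {P : Measure Ω} [IsProbabilityMeasure P] {M V : ℝ≥0 → Ω → ℝ}

/-- The Itô isometry for finite sums of weighted indicators of (possibly overlapping) intervals. -/
lemma isometry_sum (h : IsContMartWithQuadVar 𝓕 P M V) {ι : Type*} [Fintype ι] {s : ℝ≥0}
    {a b : ι → ℝ≥0} (hab : ∀ i, a i ≤ b i) (hb : ∀ i, b i ≤ s) {ξ : ι → Ω → ℝ}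
    (hξ : ∀ i, StronglyMeasurable[𝓕 (a i)] (ξ i)) (hC : ∀ i, ∃ C : ℝ, ∀ ω, |ξ i ω| ≤ C) :
    ∫⁻ ω, ‖∑ i, ξ i ω * (M (b i) ω - M (a i) ω)‖ₑ ^ 2 ∂P =
      ∫⁻ ω, ∫⁻ r, ‖∑ i, (Set.Ioc (a i : ℝ) (b i)).indicator (fun _ => ξ i ω) r‖ₑ ^ 2
        ∂(stieltjesMeasure (fun u => V u ω) s) ∂P := by
  choose C hC using hC
  have hmeas := fun i j => h.integral_mul_incr_mul_incr_eq_measure (hab i) (hab j) (hb i) (hb j)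
    (hξ i) (hξ j) (hC i) (hC j)
  have hLp : ∀ i, MemLp (fun ω => ξ i ω * (M (b i) ω - M (a i) ω)) 2 P := fun i =>
    memLp_two_mul_of_bdd ((hξ i).mono (𝓕.le _)) (hC i) ((h.memLp _).sub (h.memLp _))
  have hi : ∀ i j, Integrable
      (fun ω => ξ i ω * ξ j ω * ((M (b i) ω - M (a i) ω) * (M (b j) ω - M (a j) ω))) P :=
    fun i j => ((hLp i).integrable_mul (hLp j)).congr (ae_of_all _ fun ω => by
      simp only [Pi.mul_apply]; ring)
  have hpt : ∀ ω, (∑ i, ξ i ω * (M (b i) ω - M (a i) ω)) ^ 2 = ∑ i, ∑ j,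
      ξ i ω * ξ j ω * ((M (b i) ω - M (a i) ω) * (M (b j) ω - M (a j) ω)) := fun ω => by
    rw [pow_two, Finset.sum_mul_sum]
    exact Finset.sum_congr rfl fun i _ => Finset.sum_congr rfl fun j _ => by ring
  have hinner : ∀ᵐ ω ∂P,
      ∫⁻ r, ‖∑ i, (Set.Ioc (a i : ℝ) (b i)).indicator (fun _ => ξ i ω) r‖ₑ ^ 2
        ∂(stieltjesMeasure (fun u => V u ω) s) =
      ENNReal.ofReal (∑ i, ∑ j, ξ i ω * ξ j ω * (stieltjesMeasure (fun u => V u ω) s).real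
        (Set.Ioc (a i : ℝ) (b i) ∩ Set.Ioc (a j : ℝ) (b j))) ∧
      0 ≤ ∑ i, ∑ j, ξ i ω * ξ j ω * (stieltjesMeasure (fun u => V u ω) s).real
        (Set.Ioc (a i : ℝ) (b i) ∩ Set.Ioc (a j : ℝ) (b j)) := by
    filter_upwards [h.V_cont, h.V_mono] with ω hc hm
    have := isFiniteMeasure_stieltjesMeasure hm hc s
    obtain ⟨h1, h2⟩ := integrable_and_integral_sq_sum_indicator
      (stieltjesMeasure (fun u => V u ω) s) (s := fun i => Set.Ioc (a i : ℝ) (b i))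
      (fun i => measurableSet_Ioc) (fun i => ξ i ω)
    rw [← h2]
    refine ⟨?_, integral_nonneg fun _ => sq_nonneg _⟩
    simp_rw [enorm_sq_eq_ofReal_sq]
    rw [← ofReal_integral_eq_lintegral_ofReal h1 (ae_of_all _ fun _ => sq_nonneg _)]
  rw [lintegral_congr_ae (hinner.mono fun ω hω => hω.1),
    ← ofReal_integral_eq_lintegral_ofReal
      (integrable_finsetSum _ fun i _ => integrable_finsetSum _ fun j _ => (hmeas i j).1)
      (hinner.mono fun ω hω => hω.2)]
  simp_rw [enorm_sq_eq_ofReal_sq]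
  rw [← ofReal_integral_eq_lintegral_ofReal ((memLp_finsetSum _ fun i _ => hLp i).integrable_sq)
    (ae_of_all _ fun _ => sq_nonneg _)]
  congr 1
  simp_rw [hpt]
  rw [integral_finsetSum _ fun i _ => integrable_finsetSum _ fun j _ => hi i j,
    integral_finsetSum _ fun i _ => integrable_finsetSum _ fun j _ => (hmeas i j).1]
  refine Finset.sum_congr rfl fun i _ => ?_
  rw [integral_finsetSum _ fun j _ => hi i j, integral_finsetSum _ fun j _ => (hmeas i j).1]
  exact Finset.sum_congr rfl fun j _ => (hmeas i j).2

/-- The Itô isometry for the difference of two simple predictable processes. -/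
lemma isometry_sub (h : IsContMartWithQuadVar 𝓕 P M V) (S S' : SimplePredictable 𝓕) (s : ℝ≥0) :
    ∫⁻ ω, ‖S.integral M s ω - S'.integral M s ω‖ₑ ^ 2 ∂P =
      ∫⁻ ω, ∫⁻ r, ‖S.eval r ω - S'.eval r ω‖ₑ ^ 2
        ∂(stieltjesMeasure (fun u => V u ω) s) ∂P := by
  classical
  -- After truncating the times at `s`, a coefficient fixed later than `s` would no longer be
  -- measurable at its left endpoint. Its increment is zero, so it may be replaced by `0`.
  let ξ : SimplePredictable 𝓕 → ℕ → Ω → ℝ := fun S i => if S.time i ≤ s then S.coeff i else 0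
  have hξm : ∀ (S : SimplePredictable 𝓕) i, StronglyMeasurable[𝓕 (min (S.time i) s)] (ξ S i) := by
    intro S i
    by_cases hi : S.time i ≤ s
    · rw [min_eq_left hi]
      simpa [ξ, hi] using S.coeff_meas i
    · simpa [ξ, hi] using stronglyMeasurable_zero
  have hξC : ∀ (S : SimplePredictable 𝓕) i, ∃ C : ℝ, ∀ ω, |ξ S i ω| ≤ C := by
    intro S i
    obtain ⟨C, hC⟩ := S.coeff_bdd
    refine ⟨C, fun ω => ?_⟩
    by_cases hi : S.time i ≤ s
    · simpa [ξ, hi] using hC i ω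
    · simpa [ξ, hi] using (abs_nonneg _).trans (hC i ω)
  have hint : ∀ (S : SimplePredictable 𝓕) ω, S.integral M s ω =
      ∑ i : Fin S.n, ξ S i ω * (M (min (S.time (i + 1)) s) ω - M (min (S.time i) s) ω) := by
    intro S ω
    rw [SimplePredictable.integral, Finset.sum_range]
    refine Finset.sum_congr rfl fun i _ => ?_
    by_cases hi : S.time i ≤ s
    · simp [ξ, hi]
    · have hi' : s ≤ S.time i := le_of_not_ge hi
      simp [ξ, hi, min_eq_right hi', min_eq_right (hi'.trans (S.time_mono (Nat.le_succ i)))]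
  have heval : ∀ (S : SimplePredictable 𝓕) ω (r : ℝ), r ≤ s → S.eval r ω =
      ∑ i : Fin S.n, (Set.Ioc ((min (S.time i) s : ℝ≥0) : ℝ)
        (min (S.time (i + 1)) s : ℝ≥0)).indicator (fun _ => ξ S i ω) r := by
    intro S ω r hr
    rw [SimplePredictable.eval, Finset.sum_range]
    refine Finset.sum_congr rfl fun i _ => ?_
    by_cases hi : S.time i ≤ s
    · simp [ξ, hi, Set.indicator, Set.mem_Ioc, hr]
    · have : (s : ℝ) < S.time i := by exact_mod_cast not_le.1 hi
      have hn : ¬ (S.time i : ℝ) < r := by linarith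
      simp [ξ, hi, Set.indicator, hn]
  -- The difference is a single sum over the disjoint union of the index sets; since overlapping
  -- intervals are allowed, no common refinement is needed.
  have key := h.isometry_sum (ι := Fin S.n ⊕ Fin S'.n) (s := s)
    (a := Sum.elim (fun i => min (S.time i) s) fun i => min (S'.time i) s)
    (b := Sum.elim (fun i => min (S.time (i + 1)) s) fun i => min (S'.time (i + 1)) s)
    (ξ := Sum.elim (fun i => ξ S i) fun i => - ξ S' i) ?_ ?_ ?_ ?_
  · simp only [Fintype.sum_sum_type, Sum.elim_inl, Sum.elim_inr] at key
    convert key using 1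
    · refine lintegral_congr fun ω => ?_
      rw [hint, hint]
      simp [sub_eq_add_neg]
    · refine lintegral_congr fun ω => lintegral_congr_ae ?_
      filter_upwards [ae_stieltjesMeasure_mem _ s] with r hr
      rw [heval S ω r hr.2, heval S' ω r hr.2, sub_eq_add_neg, ← Finset.sum_neg_distrib]
      congr 4
      ext i
      by_cases hi : r ∈ Set.Ioc ((min (S'.time i) s : ℝ≥0) : ℝ) (min (S'.time (i + 1)) s : ℝ≥0)
      · simp only [Set.indicator_of_mem hi, Pi.neg_apply]
      · simp only [Set.indicator_of_notMem hi, neg_zero]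
  · rintro (i | i)
    · exact min_le_min_right _ (S.time_mono (Nat.le_succ i))
    · exact min_le_min_right _ (S'.time_mono (Nat.le_succ i))
  · rintro (i | i) <;> exact min_le_right _ _
  · rintro (i | i)
    · exact hξm S i
    · exact (hξm S' i).neg
  · rintro (i | i)
    · exact hξC S i
    · simpa using hξC S' i

end IsContMartWithQuadVar

/-! ### Riemann sums on uniform grids and integration by parts -/

/-- The point `i s / (n + 1)` of the uniform grid on `[0, s]`. -/
def gridPoint (s : ℝ≥0) (n i : ℕ) : ℝ≥0 := i * (s / (n + 1))

lemma gridPoint_mono (s : ℝ≥0) (n : ℕ) : Monotone (gridPoint s n) := fun i j hij => by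
  unfold gridPoint; gcongr

lemma gridPoint_zero (s : ℝ≥0) (n : ℕ) : gridPoint s n 0 = 0 := by simp [gridPoint]

lemma gridPoint_last (s : ℝ≥0) (n : ℕ) : gridPoint s n (n + 1) = s := by
  unfold gridPoint; push_cast; field_simp

lemma gridPoint_le {s : ℝ≥0} {n i : ℕ} (hi : i ≤ n + 1) : gridPoint s n i ≤ s :=
  (gridPoint_mono s n hi).trans_eq (gridPoint_last s n)

lemma gridPoint_succ_sub (s : ℝ≥0) (n i : ℕ) :
    (gridPoint s n (i + 1) : ℝ) - gridPoint s n i = s / (n + 1) := by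
  simp [gridPoint]; ring

lemma gridPoint_succ_sub_tendsto (s : ℝ≥0) :
    Tendsto (fun n : ℕ => (s : ℝ) / (n + 1)) atTop (𝓝 0) :=
  tendsto_const_div_atTop_nhds_zero_nat (s : ℝ) |>.comp (tendsto_add_atTop_nat 1) |>.congr
    fun n => by simp

lemma exists_mem_Ioc_gridPoint {s : ℝ≥0} (n : ℕ) {r : ℝ} (hr : r ∈ Set.Ioc (0 : ℝ) s) :
    ∃ i < n + 1, r ∈ Set.Ioc (gridPoint s n i : ℝ) (gridPoint s n (i + 1)) := by
  have hex : ∃ i, r ≤ gridPoint s n i := ⟨n + 1, by rw [gridPoint_last]; exact hr.2⟩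
  classical
  have h0 : Nat.find hex ≠ 0 := fun h => by
    have := Nat.find_spec hex
    rw [h, gridPoint_zero] at this
    exact absurd hr.1 (not_lt.2 (by simpa using this))
  obtain ⟨i, hi⟩ := Nat.exists_eq_succ_of_ne_zero h0
  refine ⟨i, ?_, ?_, ?_⟩
  · have : Nat.find hex ≤ n + 1 := Nat.find_min' hex (by rw [gridPoint_last]; exact hr.2)
    omega
  · exact not_le.1 (Nat.find_min hex (by omega : i < Nat.find hex))
  · have := Nat.find_spec hex
    rwa [hi] at this

/-- The deterministic step process with values `H (t_i)` on `(t_i, t_{i+1}]`, for the uniform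
grid `t_i` on `[0, s]`. -/
def gridStep (𝓕 : Filtration ℝ≥0 mΩ) (H : ℝ → ℝ) (s : ℝ≥0) (n : ℕ) : SimplePredictable 𝓕 where
  n := n + 1
  time := gridPoint s n
  time_mono := gridPoint_mono s n
  -- The cutoff provides one bound for the coefficients at all indices, including those beyond the
  -- grid.
  coeff i _ := if i < n + 1 then H (gridPoint s n i) else 0
  coeff_meas _ := stronglyMeasurable_const
  coeff_bdd := by
    refine ⟨∑ j ∈ Finset.range (n + 1), |H (gridPoint s n j)|, fun i _ => ?_⟩
    split_ifs with hi
    · exact Finset.single_le_sum (f := fun j => |H (gridPoint s n j)|)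
        (fun _ _ => abs_nonneg _) (Finset.mem_range.2 hi)
    · simpa using Finset.sum_nonneg fun _ _ => abs_nonneg _

lemma gridStep_integral (𝓕 : Filtration ℝ≥0 mΩ) (H : ℝ → ℝ) (s : ℝ≥0) (n : ℕ)
    (X : ℝ≥0 → Ω → ℝ) (ω : Ω) : (gridStep 𝓕 H s n).integral X s ω =
      ∑ i ∈ Finset.range (n + 1), H (gridPoint s n i) *
        (X (gridPoint s n (i + 1)) ω - X (gridPoint s n i) ω) := by
  refine Finset.sum_congr rfl fun i hi => ?_
  have hi' := Finset.mem_range.1 hi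
  simp only [gridStep, hi', if_true, min_eq_left (gridPoint_le (s := s) (n := n) hi'),
    min_eq_left (gridPoint_le (s := s) (n := n) hi'.le)]

lemma gridStep_eval_eq (𝓕 : Filtration ℝ≥0 mΩ) (H : ℝ → ℝ) {s : ℝ≥0} {n i : ℕ}
    (hi : i < n + 1) {r : ℝ} (hr : r ∈ Set.Ioc (gridPoint s n i : ℝ) (gridPoint s n (i + 1)))
    (ω : Ω) : (gridStep 𝓕 H s n).eval r ω = H (gridPoint s n i) := by
  unfold SimplePredictable.eval
  refine (Finset.sum_eq_single_of_mem i (Finset.mem_range.2 hi) ?_).trans ?_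
  · intro j _ hj
    refine Set.indicator_of_notMem (fun hr' => ?_) _
    simp only [gridStep] at hr'
    rcases lt_or_gt_of_ne hj with h | h
    · have h2 : (gridPoint s n (j + 1) : ℝ) ≤ gridPoint s n i := by
        exact_mod_cast gridPoint_mono s n h
      linarith [hr.1, hr'.2]
    · have h2 : (gridPoint s n (i + 1) : ℝ) ≤ gridPoint s n j := by
        exact_mod_cast gridPoint_mono s n h
      linarith [hr.2, hr'.1]
  · simp only [gridStep]
    rw [Set.indicator_of_mem hr, if_pos hi]

/-- The left endpoint serves step approximations of integrands, the right endpoint the paths that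
appear after summation by parts. -/
lemma eventually_abs_sub_le_on_grid {s : ℝ≥0} {f : ℝ → ℝ} (hf : ContinuousOn f (Set.Icc 0 s))
    {ε : ℝ} (hε : 0 < ε) : ∀ᶠ n : ℕ in atTop, ∀ i < n + 1, ∀ r,
      r ∈ Set.Icc (gridPoint s n i : ℝ) (gridPoint s n (i + 1)) →
      |f (gridPoint s n i) - f r| ≤ ε ∧ |f (gridPoint s n (i + 1)) - f r| ≤ ε := by
  have hu := isCompact_Icc.uniformContinuousOn_of_continuous hf
  obtain ⟨δ, hδ, hd⟩ := Metric.uniformContinuousOn_iff.1 hu ε hε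
  filter_upwards [(gridPoint_succ_sub_tendsto s).eventually (gt_mem_nhds hδ)] with n hn i hi r hr
  have h1 : (gridPoint s n i : ℝ) ≤ s := by exact_mod_cast gridPoint_le hi.le
  have h2 : (gridPoint s n (i + 1) : ℝ) ≤ s := by exact_mod_cast gridPoint_le hi
  have h3 := (gridPoint s n i).coe_nonneg
  have h4 := (gridPoint s n (i + 1)).coe_nonneg
  have h5 := gridPoint_succ_sub s n i
  have hrm : r ∈ Set.Icc (0 : ℝ) s := ⟨h3.trans hr.1, hr.2.trans h2⟩
  constructor
  · refine (hd _ ⟨h3, h1⟩ r hrm ?_).le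
    rw [Real.dist_eq, abs_sub_lt_iff]; constructor <;> linarith [hr.1, hr.2]
  · refine (hd _ ⟨h4, h2⟩ r hrm ?_).le
    rw [Real.dist_eq, abs_sub_lt_iff]; constructor <;> linarith [hr.1, hr.2]

lemma eventually_abs_gridStep_eval_sub_le (𝓕 : Filtration ℝ≥0 mΩ) {H : ℝ → ℝ} {s : ℝ≥0}
    (hH : ContinuousOn H (Set.Icc 0 s)) {ε : ℝ} (hε : 0 < ε) :
    ∀ᶠ n : ℕ in atTop, ∀ ω, ∀ r ∈ Set.Ioc (0 : ℝ) s,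
      |(gridStep 𝓕 H s n).eval r ω - H r| ≤ ε := by
  filter_upwards [eventually_abs_sub_le_on_grid hH hε] with n hn ω r hr
  obtain ⟨i, hi, hri⟩ := exists_mem_Ioc_gridPoint n hr
  rw [gridStep_eval_eq 𝓕 H hi hri]
  exact (hn i hi r ⟨hri.1.le, hri.2⟩).1

lemma sum_mul_sub_eq_sub_sum (f g : ℕ → ℝ) (n : ℕ) :
    ∑ i ∈ Finset.range n, f i * (g (i + 1) - g i) =
      f n * g n - f 0 * g 0 - ∑ i ∈ Finset.range n, g (i + 1) * (f (i + 1) - f i) := by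
  induction n with
  | zero => simp
  | succ n ih => rw [Finset.sum_range_succ, Finset.sum_range_succ, ih]; ring

/-- Integration by parts: the Riemann–Stieltjes sums of an absolutely continuous function against
a continuous path converge. -/
lemma tendsto_sum_grid {H h : ℝ → ℝ} {s : ℝ≥0} (hh : IntervalIntegrable h volume 0 s)
    (hH : ∀ r ∈ Set.Icc (0 : ℝ) s, H r = H s - ∫ u in r..s, h u)
    {x : ℝ≥0 → ℝ} (hx : ContinuousOn x (Set.Iic s)) (hx0 : x 0 = 0) :
    Tendsto (fun n => ∑ i ∈ Finset.range (n + 1), H (gridPoint s n i) *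
        (x (gridPoint s n (i + 1)) - x (gridPoint s n i))) atTop
      (𝓝 (H s * x s - ∫ r in (0 : ℝ)..s, x r.toNNReal * h r)) := by
  have hs0 : (0 : ℝ) ≤ s := s.coe_nonneg
  have hsub : ∀ {a b : ℝ}, 0 ≤ a → a ≤ s → 0 ≤ b → b ≤ s →
      Set.uIcc a b ⊆ Set.uIcc 0 (s : ℝ) := fun h1 h2 h3 h4 => by
    rw [Set.uIcc_of_le hs0]
    exact Set.uIcc_subset_Icc ⟨h1, h2⟩ ⟨h3, h4⟩
  have hy : ContinuousOn (fun r : ℝ => x r.toNNReal) (Set.Icc 0 s) :=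
    hx.comp continuous_real_toNNReal.continuousOn fun r hr => by
      simpa [Set.mem_Iic] using (Real.toNNReal_le_iff_le_coe.2 hr.2)
  have hxh : IntervalIntegrable (fun r => x r.toNNReal * h r) volume 0 s :=
    hh.continuousOn_mul (by rwa [Set.uIcc_of_le hs0])
  set L := ∫ r in (0 : ℝ)..s, |h r|
  have hL : 0 ≤ L := intervalIntegral.integral_nonneg hs0 fun _ _ => abs_nonneg _
  rw [Metric.tendsto_atTop]
  intro ε hε
  -- The final error is at most `δ * L`, with `L` the `L¹` norm of `h`; the `+ 1` covers `L = 0`.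
  obtain ⟨δ, hδe⟩ : ∃ δ, δ = ε / (L + 1) := ⟨_, rfl⟩
  have hδ : 0 < δ := by rw [hδe]; positivity
  obtain ⟨N, hN⟩ := eventually_atTop.1 (eventually_abs_sub_le_on_grid hy hδ)
  refine ⟨N, fun n hn => ?_⟩
  have hb : ∀ {i}, i ≤ n + 1 → (gridPoint s n i : ℝ) ∈ Set.Icc (0 : ℝ) s := fun hi =>
    ⟨NNReal.coe_nonneg _, by exact_mod_cast gridPoint_le hi⟩
  have hle : ∀ i, (gridPoint s n i : ℝ) ≤ gridPoint s n (i + 1) := fun i => by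
    exact_mod_cast gridPoint_mono s n (Nat.le_succ i)
  have hsubi : ∀ {i}, i < n + 1 →
      Set.uIcc (gridPoint s n i : ℝ) (gridPoint s n (i + 1)) ⊆ Set.uIcc 0 (s : ℝ) := fun hi =>
    hsub (hb hi.le).1 (hb hi.le).2 (hb hi).1 (hb hi).2
  have hHd : ∀ i < n + 1, H (gridPoint s n (i + 1)) - H (gridPoint s n i) =
      ∫ u in (gridPoint s n i : ℝ)..gridPoint s n (i + 1), h u := by
    intro i hi
    rw [hH _ (hb hi.le), hH _ (hb hi), ← intervalIntegral.integral_add_adjacent_intervals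
      (hh.mono_set (hsubi hi)) (hh.mono_set (hsub (hb hi).1 (hb hi).2 hs0 le_rfl))]
    ring
  rw [sum_mul_sub_eq_sub_sum (fun i => H (gridPoint s n i)) (fun i => x (gridPoint s n i)),
    gridPoint_last, gridPoint_zero, hx0, mul_zero, sub_zero, Real.dist_eq]
  have hsum : ∫ r in (0 : ℝ)..s, x r.toNNReal * h r = ∑ i ∈ Finset.range (n + 1),
      ∫ r in (gridPoint s n i : ℝ)..gridPoint s n (i + 1), x r.toNNReal * h r := by
    rw [intervalIntegral.sum_integral_adjacent_intervals
      (a := fun i => (gridPoint s n i : ℝ)) fun i hi => hxh.mono_set (hsubi hi),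
      gridPoint_last, gridPoint_zero, NNReal.coe_zero]
  have hsumL : L = ∑ i ∈ Finset.range (n + 1),
      ∫ r in (gridPoint s n i : ℝ)..gridPoint s n (i + 1), |h r| := by
    rw [intervalIntegral.sum_integral_adjacent_intervals
      (a := fun i => (gridPoint s n i : ℝ)) fun i hi => hh.abs.mono_set (hsubi hi),
      gridPoint_last, gridPoint_zero, NNReal.coe_zero]
  have hbound : |∑ i ∈ Finset.range (n + 1), (∫ r in (gridPoint s n i : ℝ)..gridPoint s n (i + 1),
      (x r.toNNReal - x (gridPoint s n (i + 1))) * h r)| ≤ δ * L := by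
    rw [hsumL, Finset.mul_sum]
    refine (Finset.abs_sum_le_sum_abs _ _).trans (Finset.sum_le_sum fun i hi => ?_)
    have hi' := Finset.mem_range.1 hi
    rw [← intervalIntegral.integral_const_mul, ← Real.norm_eq_abs]
    refine intervalIntegral.norm_integral_le_of_norm_le (hle i) (ae_of_all _ fun r hr => ?_)
      ((hh.abs.mono_set (hsubi hi')).const_mul _)
    rw [norm_mul, Real.norm_eq_abs, Real.norm_eq_abs, abs_sub_comm]
    have := (hN n hn i hi' r ⟨hr.1.le, hr.2⟩).2
    rw [Real.toNNReal_coe] at this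
    exact mul_le_mul_of_nonneg_right this (abs_nonneg _)
  -- Summation by parts moves the differences onto `H`, so on each cell the error is the oscillation
  -- of `x` integrated against `h`. Continuity of `x` suffices; it need not have bounded variation.
  have heq : H s * x s - ∑ i ∈ Finset.range (n + 1), x (gridPoint s n (i + 1)) *
      (H (gridPoint s n (i + 1)) - H (gridPoint s n i)) -
      (H s * x s - ∫ r in (0 : ℝ)..s, x r.toNNReal * h r) =
      ∑ i ∈ Finset.range (n + 1), (∫ r in (gridPoint s n i : ℝ)..gridPoint s n (i + 1),
      (x r.toNNReal - x (gridPoint s n (i + 1))) * h r) := by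
    rw [hsum, sub_sub_sub_cancel_left, ← Finset.sum_sub_distrib]
    refine Finset.sum_congr rfl fun i hi => ?_
    have hi' := Finset.mem_range.1 hi
    rw [hHd i hi', ← intervalIntegral.integral_const_mul, ← intervalIntegral.integral_sub
      (hxh.mono_set (hsubi hi')) ((hh.mono_set (hsubi hi')).const_mul _)]
    simp_rw [sub_mul]
  rw [heq]
  refine hbound.trans_lt ?_
  rw [hδe, div_mul_eq_mul_div, div_lt_iff₀ (by linarith)]
  nlinarith

lemma integrable_stieltjesMeasure {A : ℝ≥0 → ℝ} (hA : Monotone A) (hc : Continuous A) {s : ℝ≥0}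
    {H : ℝ → ℝ} (hH : ContinuousOn H (Set.Icc 0 s)) : Integrable H (stieltjesMeasure A s) := by
  have := isFiniteMeasure_stieltjesMeasure hA hc s
  have hmem : ∀ᵐ r ∂(stieltjesMeasure A s), r ∈ Set.Icc (0 : ℝ) s :=
    (ae_stieltjesMeasure_mem A s).mono fun r hr => ⟨hr.1.le, hr.2⟩
  obtain ⟨C, hC⟩ := isCompact_Icc.exists_bound_of_continuousOn hH
  refine Integrable.of_bound ?_ C (hmem.mono hC)
  rw [← Measure.restrict_eq_self_of_ae_mem hmem]
  exact hH.aestronglyMeasurable measurableSet_Icc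

lemma tendsto_sum_grid_integral_stieltjesMeasure {A : ℝ≥0 → ℝ} (hA : Monotone A)
    (hc : Continuous A) {s : ℝ≥0} {H : ℝ → ℝ} (hH : ContinuousOn H (Set.Icc 0 s)) :
    Tendsto (fun n => ∑ i ∈ Finset.range (n + 1), H (gridPoint s n i) *
        (A (gridPoint s n (i + 1)) - A (gridPoint s n i))) atTop
      (𝓝 (∫ r, H r ∂(stieltjesMeasure A s))) := by
  have := isFiniteMeasure_stieltjesMeasure hA hc s
  set μ := stieltjesMeasure A s
  -- A one-point sample space turns `gridStep` into a deterministic step function. Its integral is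
  -- the Riemann sum, and it converges uniformly to `H` on `(0, s]`.
  let 𝓖 : Filtration ℝ≥0 (⊤ : MeasurableSpace Unit) := ⊤
  let D : ℕ → ℝ → ℝ := fun n r => (gridStep 𝓖 H s n).eval r ()
  have hterm : ∀ n i, Integrable (fun r => (Set.Ioc (gridPoint s n i : ℝ)
      (gridPoint s n (i + 1))).indicator
        (fun _ => (gridStep 𝓖 H s n).coeff i ()) r) μ := fun n i =>
    (integrable_const _).indicator measurableSet_Ioc
  have hDi : ∀ n, Integrable (D n) μ := fun n => integrable_finsetSum _ fun i _ => hterm n i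
  have hD : ∀ n, ∫ r, D n r ∂μ = ∑ i ∈ Finset.range (n + 1), H (gridPoint s n i) *
        (A (gridPoint s n (i + 1)) - A (gridPoint s n i)) := by
    intro n
    refine (integral_finsetSum _ fun i _ => hterm n i).trans (Finset.sum_congr rfl fun i hi => ?_)
    have hi' : i < n + 1 := Finset.mem_range.1 hi
    rw [integral_indicator_const _ measurableSet_Ioc, smul_eq_mul, mul_comm,
      stieltjesMeasure_real_Ioc hA hc s (gridPoint_mono s n (Nat.le_succ i)),
      min_eq_left (gridPoint_le hi'), min_eq_left (gridPoint_le hi'.le)]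
    simp only [gridStep, hi', if_true]
  simp_rw [← hD]
  rw [Metric.tendsto_atTop]
  intro ε hε
  have hδ : 0 < ε / (μ.real Set.univ + 1) := by positivity
  obtain ⟨N, hN⟩ := eventually_atTop.1 (eventually_abs_gridStep_eval_sub_le 𝓖 hH hδ)
  refine ⟨N, fun n hn => ?_⟩
  rw [dist_eq_norm, ← integral_sub (hDi n) (integrable_stieltjesMeasure hA hc hH)]
  refine (norm_integral_le_of_norm_le_const
    ((ae_stieltjesMeasure_mem A s).mono fun r hr => hN n hn () r hr)).trans_lt ?_
  rw [div_mul_eq_mul_div, div_lt_iff₀ (by positivity)]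
  nlinarith

/-! ### The Itô integral of a continuous deterministic integrand -/

lemma eLpNorm_two_sq {P : Measure Ω} (f : Ω → ℝ) : eLpNorm f 2 P ^ 2 = ∫⁻ ω, ‖f ω‖ₑ ^ 2 ∂P := by
  rw [eLpNorm_eq_lintegral_rpow_enorm_toReal (by simp) (by simp), ← ENNReal.rpow_natCast,
    ← ENNReal.rpow_mul]
  simp

lemma tendsto_eLpNorm_two_iff {P : Measure Ω} {f : ℕ → Ω → ℝ} :
    Tendsto (fun n => eLpNorm (f n) 2 P) atTop (𝓝 0) ↔
      Tendsto (fun n => ∫⁻ ω, ‖f n ω‖ₑ ^ 2 ∂P) atTop (𝓝 0) := by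
  simp_rw [← eLpNorm_two_sq]
  constructor
  · intro h
    have := ENNReal.Tendsto.pow (n := 2) h
    simpa using this
  · intro h
    have := (ENNReal.continuous_rpow_const (y := (1 / 2 : ℝ))).tendsto 0 |>.comp h
    rw [ENNReal.zero_rpow_of_pos (by norm_num)] at this
    refine this.congr fun n => ?_
    simp only [Function.comp]
    rw [← ENNReal.rpow_natCast, ← ENNReal.rpow_mul]
    simp

lemma SimplePredictable.stronglyMeasurable_integral {𝓕 : Filtration ℝ≥0 mΩ}
    (S : SimplePredictable 𝓕) {M : ℝ≥0 → Ω → ℝ} (hM : ∀ t, StronglyMeasurable (M t)) (s : ℝ≥0) :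
    StronglyMeasurable (S.integral M s) := by
  unfold SimplePredictable.integral
  exact Finset.stronglyMeasurable_fun_sum _ fun i _ =>
    ((S.coeff_meas i).mono (𝓕.le _)).mul ((hM _).sub (hM _))

lemma exists_pos_ofReal_sq_mul_le (C : ℝ≥0∞) (hC : C ≠ ∞) {ε : ℝ≥0∞} (hε : 0 < ε) :
    ∃ δ : ℝ, 0 < δ ∧ ENNReal.ofReal (δ ^ 2) * C ≤ ε := by
  have : Tendsto (fun δ : ℝ => ENNReal.ofReal (δ ^ 2) * C) (𝓝[>] 0) (𝓝 0) := by
    have h1 : Tendsto (fun δ : ℝ => ENNReal.ofReal (δ ^ 2)) (𝓝 0) (𝓝 (ENNReal.ofReal (0 ^ 2))) :=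
      (ENNReal.continuous_ofReal.comp (continuous_pow 2)).tendsto 0
    have h2 := ENNReal.Tendsto.mul_const h1 (Or.inr hC)
    simp only [ne_eq, OfNat.ofNat_ne_zero, not_false_eq_true, zero_pow, ENNReal.ofReal_zero,
      zero_mul] at h2
    exact h2.mono_left nhdsWithin_le_nhds
  obtain ⟨δ, h1, h2⟩ := ((this.eventually (gt_mem_nhds hε)).and self_mem_nhdsWithin).exists
  exact ⟨δ, h2, h1.le⟩

namespace IsContMartWithQuadVar

variable {𝓕 : Filtration ℝ≥0 mΩ} {P : Measure Ω} {M V : ℝ≥0 → Ω → ℝ}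

lemma lintegral_const_stieltjesMeasure (h : IsContMartWithQuadVar 𝓕 P M V) (s : ℝ≥0)
    (C : ℝ≥0∞) : ∫⁻ ω, ∫⁻ _, C ∂(stieltjesMeasure (fun u => V u ω) s) ∂P =
      C * ENNReal.ofReal (∫ ω, V s ω ∂P) := by
  have : ∀ᵐ ω ∂P, ∫⁻ _, C ∂(stieltjesMeasure (fun u => V u ω) s) =
      C * ENNReal.ofReal (V s ω) := by
    filter_upwards [h.V_cont, h.V_mono, h.V_zero] with ω hc hm h0
    rw [lintegral_const, stieltjesMeasure_univ hm hc, h0, sub_zero]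
  rw [lintegral_congr_ae this, lintegral_const_mul _
    (h.V_stronglyMeasurable s).measurable.ennreal_ofReal,
    ofReal_integral_eq_lintegral_ofReal (h.V_integrable s)
      ((h.ae_V_mem (σ := fun _ => s) fun _ => le_rfl).mono fun ω hω => hω.1)]

lemma lintegral_gridStep_sub_le (h : IsContMartWithQuadVar 𝓕 P M V) {s : ℝ≥0} {H : ℝ → ℝ}
    (hH : ContinuousOn H (Set.Icc 0 s)) {δ : ℝ} (hδ : 0 < δ) :
    ∀ᶠ n in atTop, ∫⁻ ω, ∫⁻ r, ‖(gridStep 𝓕 H s n).eval r ω - H r‖ₑ ^ 2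
      ∂(stieltjesMeasure (fun u => V u ω) s) ∂P ≤
        ENNReal.ofReal (δ ^ 2) * ENNReal.ofReal (∫ ω, V s ω ∂P) := by
  filter_upwards [eventually_abs_gridStep_eval_sub_le 𝓕 hH hδ] with n hn
  rw [← h.lintegral_const_stieltjesMeasure]
  refine lintegral_mono fun ω => lintegral_mono_ae ?_
  filter_upwards [ae_stieltjesMeasure_mem _ s] with r hr
  rw [enorm_sq_eq_ofReal_sq]
  exact ENNReal.ofReal_le_ofReal (sq_le_sq' (abs_le.1 (hn ω r hr)).1 (abs_le.1 (hn ω r hr)).2)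

lemma tendsto_lintegral_gridStep_sub (h : IsContMartWithQuadVar 𝓕 P M V) {s : ℝ≥0} {H : ℝ → ℝ}
    (hH : ContinuousOn H (Set.Icc 0 s)) :
    Tendsto (fun n => ∫⁻ ω, ∫⁻ r, ‖(gridStep 𝓕 H s n).eval r ω - H r‖ₑ ^ 2
      ∂(stieltjesMeasure (fun u => V u ω) s) ∂P) atTop (𝓝 0) := by
  rw [ENNReal.tendsto_nhds_zero]
  intro ε hε
  obtain ⟨δ, hδ, hle⟩ := exists_pos_ofReal_sq_mul_le (ENNReal.ofReal (∫ ω, V s ω ∂P)) (by simp) hε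
  exact (h.lintegral_gridStep_sub_le hH hδ).mono fun n hn => hn.trans hle

lemma aestronglyMeasurable_limit (h : IsContMartWithQuadVar 𝓕 P M V) {s : ℝ≥0}
    {H : ℝ → ℝ} {I : Ω → ℝ}
    (hI : ∀ᵐ ω ∂P, Tendsto (fun n => (gridStep 𝓕 H s n).integral M s ω) atTop (𝓝 (I ω))) :
    AEStronglyMeasurable I P :=
  aestronglyMeasurable_of_tendsto_ae atTop (fun n => ((gridStep 𝓕 H s n
    ).stronglyMeasurable_integral h.stronglyMeasurable s).aestronglyMeasurable) hI

variable [IsProbabilityMeasure P]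

/-- `E |∫ S dM - ∫ D_n dM|²` is controlled by `E ∫ |S - H|² dV`. -/
lemma lintegral_integral_sub_gridStep_le (h : IsContMartWithQuadVar 𝓕 P M V) {s : ℝ≥0}
    {H : ℝ → ℝ} (hH : ContinuousOn H (Set.Icc 0 s)) {δ : ℝ} (hδ : 0 < δ) :
    ∀ᶠ n in atTop, ∀ S : SimplePredictable 𝓕,
      ∫⁻ ω, ‖S.integral M s ω - (gridStep 𝓕 H s n).integral M s ω‖ₑ ^ 2 ∂P ≤
        2 * (∫⁻ ω, ∫⁻ r, ‖S.eval r ω - H r‖ₑ ^ 2 ∂(stieltjesMeasure (fun u => V u ω) s) ∂P) +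
          ENNReal.ofReal (2 * δ ^ 2) * ENNReal.ofReal (∫ ω, V s ω ∂P) := by
  filter_upwards [eventually_abs_gridStep_eval_sub_le 𝓕 hH hδ] with n hn S
  rw [h.isometry_sub, ← h.lintegral_const_stieltjesMeasure]
  -- Splitting the integral of a sum requires measurability of one summand only. The constant term
  -- is used, so that nothing has to be known about `ω ↦ ∫ |S - H|² dV`.
  have hm : AEMeasurable (fun ω => ∫⁻ _, ENNReal.ofReal (2 * δ ^ 2)
      ∂(stieltjesMeasure (fun u => V u ω) s)) P := by
    refine ⟨fun ω => ENNReal.ofReal (2 * δ ^ 2) * ENNReal.ofReal (V s ω),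
      (h.V_stronglyMeasurable s).measurable.ennreal_ofReal.const_mul _, ?_⟩
    filter_upwards [h.V_cont, h.V_mono, h.V_zero] with ω hc hm h0
    rw [lintegral_const, stieltjesMeasure_univ hm hc, h0, sub_zero]
  rw [← lintegral_const_mul' _ _ (by simp), ← lintegral_add_right' _ hm]
  refine lintegral_mono fun ω => ?_
  rw [← lintegral_const_mul' _ _ (by simp), ← lintegral_add_right _ measurable_const]
  refine lintegral_mono_ae ?_
  filter_upwards [ae_stieltjesMeasure_mem _ s] with r hr
  have h2 : (2 : ℝ≥0∞) = ENNReal.ofReal 2 := by simp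
  rw [enorm_sq_eq_ofReal_sq, enorm_sq_eq_ofReal_sq, h2, ← ENNReal.ofReal_mul (by norm_num),
    ← ENNReal.ofReal_add (by positivity) (by positivity)]
  refine ENNReal.ofReal_le_ofReal ?_
  have h3 := sq_le_sq' (abs_le.1 (hn ω r hr)).1 (abs_le.1 (hn ω r hr)).2
  have h4 := sq_nonneg ((S.eval r ω - H r) + ((gridStep 𝓕 H s n).eval r ω - H r))
  nlinarith

lemma memLp_integral_gridStep (h : IsContMartWithQuadVar 𝓕 P M V) (H : ℝ → ℝ) (s : ℝ≥0)
    (n : ℕ) : MemLp ((gridStep 𝓕 H s n).integral M s) 2 P := by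
  have : (gridStep 𝓕 H s n).integral M s = fun ω => ∑ i ∈ Finset.range (n + 1),
      H (gridPoint s n i) * (M (gridPoint s n (i + 1)) ω - M (gridPoint s n i) ω) :=
    funext fun ω => gridStep_integral 𝓕 H s n M ω
  rw [this]
  exact memLp_finsetSum _ fun i _ => ((h.memLp _).sub (h.memLp _)).const_mul _

/-- Compare `S` with the grid steps by the isometry, apply Fatou's lemma along their almost sure
limit `I`, and let `δ` tend to `0`. Any simple processes approximating `H` must therefore have
integrals converging to `I`; the factor `2` is harmless. -/
lemma lintegral_integral_sub_limit_le (h : IsContMartWithQuadVar 𝓕 P M V) {s : ℝ≥0}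
    {H : ℝ → ℝ} (hH : ContinuousOn H (Set.Icc 0 s)) {I : Ω → ℝ}
    (hI : ∀ᵐ ω ∂P, Tendsto (fun n => (gridStep 𝓕 H s n).integral M s ω) atTop (𝓝 (I ω)))
    (S : SimplePredictable 𝓕) :
    ∫⁻ ω, ‖S.integral M s ω - I ω‖ₑ ^ 2 ∂P ≤
      2 * ∫⁻ ω, ∫⁻ r, ‖S.eval r ω - H r‖ₑ ^ 2 ∂(stieltjesMeasure (fun u => V u ω) s) ∂P := by
  refine ENNReal.le_of_forall_pos_le_add fun ε hε _ => ?_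
  obtain ⟨δ, hδ, hle⟩ := exists_pos_ofReal_sq_mul_le (2 * ENNReal.ofReal (∫ ω, V s ω ∂P))
    (ENNReal.mul_ne_top (by simp) (by simp)) (ENNReal.coe_pos.2 hε)
  have hSm : ∀ S : SimplePredictable 𝓕, StronglyMeasurable (S.integral M s) := fun S =>
    S.stronglyMeasurable_integral h.stronglyMeasurable s
  calc ∫⁻ ω, ‖S.integral M s ω - I ω‖ₑ ^ 2 ∂P
      = ∫⁻ ω, liminf (fun m =>
          ‖S.integral M s ω - (gridStep 𝓕 H s m).integral M s ω‖ₑ ^ 2) atTop ∂P := by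
        refine lintegral_congr_ae ?_
        filter_upwards [hI] with ω hω
        refine (Tendsto.liminf_eq ?_).symm
        exact ENNReal.Tendsto.pow ((tendsto_const_nhds.sub hω).enorm)
    _ ≤ liminf (fun m => ∫⁻ ω,
          ‖S.integral M s ω - (gridStep 𝓕 H s m).integral M s ω‖ₑ ^ 2 ∂P) atTop :=
        lintegral_liminf_le fun m => ((hSm S).sub (hSm _)).measurable.enorm.pow_const 2
    _ ≤ _ := by
        refine liminf_le_of_le (by isBoundedDefault) fun b hb => ?_
        obtain ⟨m, hm1, hm2⟩ :=
          (hb.and (h.lintegral_integral_sub_gridStep_le hH hδ)).exists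
        refine hm1.trans ((hm2 S).trans ?_)
        gcongr
        refine le_trans (le_of_eq ?_) hle
        rw [ENNReal.ofReal_mul (by norm_num), ENNReal.ofReal_ofNat]
        ring

lemma tendsto_eLpNorm_integral_sub_limit (h : IsContMartWithQuadVar 𝓕 P M V) {s : ℝ≥0}
    {H : ℝ → ℝ} (hH : ContinuousOn H (Set.Icc 0 s)) {I : Ω → ℝ}
    (hI : ∀ᵐ ω ∂P, Tendsto (fun n => (gridStep 𝓕 H s n).integral M s ω) atTop (𝓝 (I ω)))
    {S : ℕ → SimplePredictable 𝓕}
    (hS : Tendsto (fun n => ∫⁻ ω, ∫⁻ r, ‖(S n).eval r ω - H r‖ₑ ^ 2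
      ∂(stieltjesMeasure (fun u => V u ω) s) ∂P) atTop (𝓝 0)) :
    Tendsto (fun n => eLpNorm (fun ω => (S n).integral M s ω - I ω) 2 P) atTop (𝓝 0) := by
  rw [tendsto_eLpNorm_two_iff]
  have h2 := ENNReal.Tendsto.const_mul (a := 2) hS (Or.inr (by simp))
  rw [mul_zero] at h2
  exact tendsto_of_tendsto_of_tendsto_of_le_of_le tendsto_const_nhds h2 (fun _ => zero_le)
    fun n => h.lintegral_integral_sub_limit_le hH hI (S n)

/-- For a continuous deterministic integrand the Itô integral is the almost sure limit of the
Riemann–Stieltjes sums, when these converge. -/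
lemma isItoIntegral_of_tendsto (h : IsContMartWithQuadVar 𝓕 P M V) {s : ℝ≥0} {H : ℝ → ℝ}
    (hH : ContinuousOn H (Set.Icc 0 s)) {I : Ω → ℝ}
    (hI : ∀ᵐ ω ∂P, Tendsto (fun n => (gridStep 𝓕 H s n).integral M s ω) atTop (𝓝 (I ω))) :
    IsItoIntegral 𝓕 P M V (fun r _ => H r) s I := by
  have hlim := h.tendsto_eLpNorm_integral_sub_limit hH hI (h.tendsto_lintegral_gridStep_sub hH)
  refine ⟨?_, fun n => gridStep 𝓕 H s n, h.tendsto_lintegral_gridStep_sub hH, hlim⟩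
  obtain ⟨n, hn⟩ := (hlim.eventually (gt_mem_nhds ENNReal.zero_lt_top)).exists
  have hD := h.memLp_integral_gridStep H s n
  have h1 : MemLp (fun ω => (gridStep 𝓕 H s n).integral M s ω - I ω) 2 P :=
    ⟨hD.1.sub (h.aestronglyMeasurable_limit hI), hn⟩
  convert hD.sub h1 using 1
  ext ω
  simp

/-- The integrals of the sequence witnessing `J` also converge to `I` in `L²`, so the two limits
coincide. -/
lemma isItoIntegral_unique (h : IsContMartWithQuadVar 𝓕 P M V) {s : ℝ≥0} {H : ℝ → ℝ}
    (hH : ContinuousOn H (Set.Icc 0 s)) {I J : Ω → ℝ}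
    (hI : ∀ᵐ ω ∂P, Tendsto (fun n => (gridStep 𝓕 H s n).integral M s ω) atTop (𝓝 (I ω)))
    (hJ : IsItoIntegral 𝓕 P M V (fun r _ => H r) s J) : J =ᵐ[P] I := by
  obtain ⟨hJ2, S, hS, hSJ⟩ := hJ
  have hIm := h.aestronglyMeasurable_limit hI
  have hsum := (h.tendsto_eLpNorm_integral_sub_limit hH hI hS).add hSJ
  rw [add_zero] at hsum
  have hle : eLpNorm (J - I) 2 P ≤ 0 := by
    refine ge_of_tendsto hsum (Eventually.of_forall fun n => ?_)
    have hSm : AEStronglyMeasurable ((S n).integral M s) P :=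
      ((S n).stronglyMeasurable_integral h.stronglyMeasurable s).aestronglyMeasurable
    have heq : J - I = (fun ω => (S n).integral M s ω - I ω) -
        fun ω => (S n).integral M s ω - J ω := by
      ext ω; simp
    rw [heq]
    exact eLpNorm_sub_le (hSm.sub hIm) (hSm.sub hJ2.1) (by norm_num)
  have := (eLpNorm_eq_zero_iff (hJ2.1.sub hIm) (by norm_num)).1 (le_antisymm hle (zero_le))
  filter_upwards [this] with ω hω
  simpa [sub_eq_zero] using hω

end IsContMartWithQuadVar

/-! ### The kernel integral as an absolutely continuous integrand -/

section Kernel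

variable {K : ℝ → ℝ} {T : ℝ≥0}

lemma intervalIntegrable_sub (hK : IntervalIntegrable K volume 0 T) {a b : ℝ} (ha : 0 ≤ a)
    (haT : a ≤ T) (hb : 0 ≤ b) (hbT : b ≤ T) : IntervalIntegrable K volume a b := by
  refine hK.mono_set ?_
  rw [Set.uIcc_of_le T.coe_nonneg]
  exact Set.uIcc_subset_Icc ⟨ha, haT⟩ ⟨hb, hbT⟩

lemma intervalIntegrable_comp_sub (hK : IntervalIntegrable K volume 0 T) {a b t : ℝ} (htT : t ≤ T)
    (ha : 0 ≤ a) (hat : a ≤ t) (hb : 0 ≤ b) (hbt : b ≤ t) :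
    IntervalIntegrable (fun r => K (t - r)) volume a b := by
  have := (intervalIntegrable_sub hK (a := t - a) (b := t - b) (by linarith) (by linarith)
    (by linarith) (by linarith)).comp_sub_left t
  simpa using this

lemma intervalIntegrable_comp_sub_mul (hK : IntervalIntegrable K volume 0 T) {a b t : ℝ}
    (htT : t ≤ T) (ha : 0 ≤ a) (hat : a ≤ t) (hb : 0 ≤ b) (hbt : b ≤ t) {x : ℝ≥0 → ℝ}
    (hx : ContinuousOn x (Set.Iic T)) :
    IntervalIntegrable (fun r => K (t - r) * x r.toNNReal) volume a b := by
  refine (intervalIntegrable_comp_sub hK htT ha hat hb hbt).mul_continuousOn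
    (hx.comp continuous_real_toNNReal.continuousOn fun r hr => ?_)
  have hr' : r ∈ Set.Icc 0 t := Set.uIcc_subset_Icc ⟨ha, hat⟩ ⟨hb, hbt⟩ hr
  exact Real.toNNReal_le_iff_le_coe.2 (hr'.2.trans htT)

/-- The derivative of `r ↦ ∫_s^t K(u - r) du`. -/
def kernelDiff (K : ℝ → ℝ) (s t r : ℝ) : ℝ := K (s - r) - K (t - r)

variable {s t : ℝ≥0}

lemma intervalIntegrable_kernelDiff (hK : IntervalIntegrable K volume 0 T) (hst : s ≤ t)
    (htT : t ≤ T) {a b : ℝ} (ha : 0 ≤ a) (has : a ≤ s) (hb : 0 ≤ b) (hbs : b ≤ s) :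
    IntervalIntegrable (kernelDiff K s t) volume a b := by
  have hst' : (s : ℝ) ≤ t := by exact_mod_cast hst
  have htT' : (t : ℝ) ≤ T := by exact_mod_cast htT
  exact (intervalIntegrable_comp_sub hK (hst'.trans htT') ha has hb hbs).sub
    (intervalIntegrable_comp_sub hK htT' ha (has.trans hst') hb (hbs.trans hst'))

/-- After translation and reflection every term is an integral of `K` over a subinterval of `[0,
T]`, so integrability suffices and nothing is differentiated. The form is the one `tendsto_sum_grid`
takes as hypothesis. -/
lemma kernelInt_eq (hK : IntervalIntegrable K volume 0 T) (hst : s ≤ t) (htT : t ≤ T) {r : ℝ}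
    (hr : r ∈ Set.Icc (0 : ℝ) s) :
    kernelInt K s t r = kernelInt K s t s - ∫ u in r..s, kernelDiff K s t u := by
  have hst' : (s : ℝ) ≤ t := by exact_mod_cast hst
  have htT' : (t : ℝ) ≤ T := by exact_mod_cast htT
  have hs0 := s.coe_nonneg
  obtain ⟨hr0, hrs⟩ := hr
  have e1 : ∫ u in r..s, kernelDiff K s t u =
      (∫ u in (0 : ℝ)..(s - r), K u) - ∫ u in (t - s : ℝ)..(t - r), K u := by
    unfold kernelDiff
    rw [intervalIntegral.integral_sub
      (intervalIntegrable_comp_sub hK (hst'.trans htT') hr0 hrs hs0 le_rfl)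
      (intervalIntegrable_comp_sub hK htT' hr0 (hrs.trans hst') hs0 hst'),
      intervalIntegral.integral_comp_sub_left, intervalIntegral.integral_comp_sub_left, sub_self]
  have e2 : kernelInt K s t r = ∫ u in (s - r : ℝ)..(t - r), K u := by
    unfold kernelInt; rw [intervalIntegral.integral_comp_sub_right]
  have e3 : kernelInt K s t s = ∫ u in (0 : ℝ)..(t - s), K u := by
    unfold kernelInt; rw [intervalIntegral.integral_comp_sub_right, sub_self]
  have i1 : ∀ {x : ℝ}, 0 ≤ x → x ≤ T → IntervalIntegrable K volume 0 x := fun h1 h2 =>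
    intervalIntegrable_sub hK le_rfl T.coe_nonneg h1 h2
  rw [e1, e2, e3, ← intervalIntegral.integral_interval_sub_left (i1 (by linarith) (by linarith))
    (i1 (x := s - r) (by linarith) (by linarith)), ← intervalIntegral.integral_interval_sub_left
    (i1 (x := t - r) (by linarith) (by linarith)) (i1 (x := t - s) (by linarith) (by linarith))]
  ring

lemma continuousOn_kernelInt (hK : IntervalIntegrable K volume 0 T) (hst : s ≤ t) (htT : t ≤ T) :
    ContinuousOn (kernelInt K s t) (Set.Icc 0 s) := by
  have hs0 := s.coe_nonneg
  have hint := (intervalIntegrable_iff_integrableOn_Icc_of_le hs0).1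
    (intervalIntegrable_kernelDiff hK hst htT le_rfl hs0 hs0 le_rfl)
  rw [← Set.uIcc_of_le hs0] at hint ⊢
  refine (ContinuousOn.sub (continuousOn_const (c := kernelInt K s t s))
    (intervalIntegral.continuousOn_primitive_interval_left hint)).congr fun r hr => ?_
  rw [Set.uIcc_of_le hs0] at hr
  exact kernelInt_eq hK hst htT hr

/-- The convolution `∫_0^t K(t - r) x_r dr` split at time `s`. -/
lemma integral_kernel_split (hK : IntervalIntegrable K volume 0 T) (hst : s ≤ t) (htT : t ≤ T)
    {x : ℝ≥0 → ℝ} (hx : ContinuousOn x (Set.Iic T)) :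
    IntervalIntegrable (fun r : ℝ => K (t - r) * (x r.toNNReal - x s)) volume s t ∧
    (∫ r in (0 : ℝ)..t, K (t - r) * x r.toNNReal) - ∫ r in (0 : ℝ)..s, K (s - r) * x r.toNNReal =
      (kernelInt K s t s * x s - ∫ r in (0 : ℝ)..s, x r.toNNReal * kernelDiff K s t r) +
        ∫ r in (s : ℝ)..t, K (t - r) * (x r.toNNReal - x s) := by
  have hst' : (s : ℝ) ≤ t := by exact_mod_cast hst
  have htT' : (t : ℝ) ≤ T := by exact_mod_cast htT
  have hs0 := s.coe_nonneg
  have ht0 := t.coe_nonneg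
  have i0 := intervalIntegrable_comp_sub_mul hK htT' le_rfl ht0 hs0 hst' hx
  have i1 := intervalIntegrable_comp_sub_mul hK htT' hs0 hst' ht0 le_rfl hx
  have i2 := intervalIntegrable_comp_sub_mul hK (hst'.trans htT') le_rfl hs0 hs0 le_rfl hx
  have i3 := (intervalIntegrable_comp_sub hK htT' hs0 hst' ht0 le_rfl).mul_const (x s)
  simp_rw [mul_sub]
  refine ⟨i1.sub i3, ?_⟩
  have e1 : ∫ r in (0 : ℝ)..s, x r.toNNReal * kernelDiff K s t r =
      (∫ r in (0 : ℝ)..s, K (s - r) * x r.toNNReal) -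
        ∫ r in (0 : ℝ)..s, K (t - r) * x r.toNNReal := by
    rw [← intervalIntegral.integral_sub i2 i0]
    exact intervalIntegral.integral_congr fun r _ => by simp only [kernelDiff]; ring
  -- Subtracting `x s` inside the integral over `[s, t]` is compensated exactly by the boundary term
  -- of the integration by parts.
  have e2 : kernelInt K s t s = ∫ r in (s : ℝ)..t, K (t - r) := by
    unfold kernelInt
    rw [intervalIntegral.integral_comp_sub_right, intervalIntegral.integral_comp_sub_left,
      sub_self, sub_self]
  rw [← intervalIntegral.integral_add_adjacent_intervals i0 i1,
    intervalIntegral.integral_sub i1 i3, intervalIntegral.integral_mul_const, e1, e2]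
  ring

end Kernel

/-! ### Integrability of `U` and the frozen martingale -/

/-- The time integral of a martingale against an integrable weight is integrable. -/
lemma integrable_integral_mul_martingale {P : Measure Ω} [IsProbabilityMeasure P]
    {𝓕 : Filtration ℝ≥0 mΩ} {M : ℝ≥0 → Ω → ℝ} (hM : Martingale M 𝓕 P)
    (hc : ∀ᵐ ω ∂P, Continuous fun t => M t ω) {k : ℝ → ℝ} {T : ℝ≥0}
    (hk : IntervalIntegrable k volume 0 T) :
    Integrable (fun ω => ∫ r in (0 : ℝ)..T, k r * M r.toNNReal ω) P := by
  obtain ⟨Y, hY, hMY⟩ := exists_stronglyMeasurable_uncurry_version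
    (fun t => (hM.stronglyMeasurable t).mono (𝓕.le t)) hc
  have hYe : ∀ t, M t =ᵐ[P] Y t := fun t => hMY.mono fun ω h => h t
  set ν := (volume : Measure ℝ).restrict (Set.Ioc 0 T)
  have hkν : Integrable k ν := (intervalIntegrable_iff_integrableOn_Ioc_of_le T.coe_nonneg).1 hk
  let f : Ω × ℝ → ℝ := fun p => k p.2 * Y p.2.toNNReal p.1
  have hfm : AEStronglyMeasurable f (P.prod ν) :=
    (hkν.1.comp_snd (μ := P)).mul (hY.comp_measurable
      ((measurable_real_toNNReal.comp measurable_snd).prodMk measurable_fst)).aestronglyMeasurable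
  have hYint : ∀ t, Integrable (Y t) P := fun t => (hM.integrable t).congr (hYe t)
  -- Conditional expectation contracts `L¹`, which gives a bound uniform in time and hence the
  -- integrable majorant `|k| E|M_T|` for Fubini's theorem.
  have hbd : ∀ t ≤ T, ∫ ω, |Y t ω| ∂P ≤ ∫ ω, |M T ω| ∂P := fun t ht => by
    refine le_trans (le_of_eq (integral_congr_ae ?_)) (integral_abs_condExp_le (m := 𝓕 t) (M T))
    filter_upwards [hYe t, hM.condExp_ae_eq ht] with ω h1 h2
    rw [h2, h1]
  have hf : Integrable f (P.prod ν) := by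
    rw [integrable_prod_iff' hfm]
    refine ⟨ae_of_all _ fun r => (hYint r.toNNReal).const_mul (k r), ?_⟩
    refine (hkν.norm.mul_const (∫ ω, |M T ω| ∂P)).mono' hfm.norm.prod_swap.integral_prod_right' ?_
    filter_upwards [ae_restrict_mem measurableSet_Ioc] with r hr
    have h0 : ∫ ω, ‖f (ω, r)‖ ∂P = ‖k r‖ * ∫ ω, |Y r.toNNReal ω| ∂P := by
      rw [← integral_const_mul]
      exact integral_congr_ae (ae_of_all _ fun ω => by simp [f])
    rw [h0, Real.norm_of_nonneg (by positivity)]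
    exact mul_le_mul_of_nonneg_left (hbd _ (Real.toNNReal_le_iff_le_coe.2 hr.2)) (norm_nonneg _)
  refine hf.integral_prod_left.congr ?_
  filter_upwards [hMY] with ω hω
  rw [intervalIntegral.integral_of_le T.coe_nonneg]
  exact integral_congr_ae (ae_of_all _ fun r => by simp [f, hω])

lemma measurable_of_ae_eq_of_complete {P : Measure Ω} {m : MeasurableSpace Ω}
    (hm : ∀ N : Set Ω, P N = 0 → MeasurableSet[m] N) {f g : Ω → ℝ} (hg : Measurable[m] g)
    (hfg : f =ᵐ[P] g) : Measurable[m] f := by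
  intro B hB
  have hN : P {ω | f ω ≠ g ω} = 0 := hfg
  have : f ⁻¹' B = (g ⁻¹' B \ {ω | f ω ≠ g ω}) ∪ (f ⁻¹' B ∩ {ω | f ω ≠ g ω}) := by
    ext ω
    by_cases h : f ω = g ω <;> simp [h]
  rw [this]
  exact ((hg hB).diff (hm _ hN)).union (hm _ (measure_mono_null Set.inter_subset_right hN))

namespace IsSolution

variable {K g₀ : ℝ → ℝ} {b c : ℝ} {T : ℝ≥0} {𝓕 : Filtration ℝ≥0 mΩ} {P : Measure Ω}
  {U Z : ℝ≥0 → Ω → ℝ}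

lemma continuous_frozen {x : ℝ≥0 → ℝ} (hx : ContinuousOn x (Set.Iic T)) :
    Continuous fun t => x (min t T) :=
  hx.comp_continuous (continuous_id.min continuous_const) fun _ =>
    Set.mem_Iic.2 (min_le_right _ _)

/-- In the equation at `T` the contribution of `bU` is nonpositive, because `b ≤ 0`, `K ≥ 0` and `U
≥ 0`. What remains above `U T` is a constant plus a time integral of the martingale. -/
lemma integrable_U [IsProbabilityMeasure P] (h : IsSolution K g₀ b c T 𝓕 P U Z)
    (hK : IntervalIntegrable K volume 0 T) (hK0 : ∀ t : ℝ≥0, 0 < t → t ≤ T → 0 ≤ K t) (hb : b ≤ 0) :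
    Integrable (U T) P := by
  have hT0 := T.coe_nonneg
  have hR : Integrable (fun ω => (∫ r in (0 : ℝ)..T, g₀ r) +
      c * ∫ r in (0 : ℝ)..T, K (T - r) * Z (min r.toNNReal T) ω) P :=
    (integrable_const _).add ((integrable_integral_mul_martingale h.Z_martingale
      (h.Z_cont.mono fun ω hω => continuous_frozen hω)
      (intervalIntegrable_comp_sub hK le_rfl le_rfl hT0 hT0 le_rfl)).const_mul c)
  refine hR.mono' ((h.U_adapted T le_rfl).mono (𝓕.le T)).aestronglyMeasurable ?_
  filter_upwards [h.equation T le_rfl, h.U_cont, h.Z_cont, h.U_mono, h.U_zero]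
    with ω heq hUc hZc hUm hU0
  have hUnn : ∀ r ≤ T, 0 ≤ U r ω := fun r hr =>
    hU0 ▸ hUm (Set.mem_Iic.2 (zero_le)) (Set.mem_Iic.2 hr) (zero_le (a := r))
  have iU := intervalIntegrable_comp_sub_mul hK le_rfl le_rfl hT0 hT0 le_rfl hUc
  have iZ := intervalIntegrable_comp_sub_mul hK le_rfl le_rfl hT0 hT0 le_rfl hZc
  have e1 : ∫ r in (0 : ℝ)..T, K (T - r) * (b * U r.toNNReal ω + c * Z r.toNNReal ω) =
      b * (∫ r in (0 : ℝ)..T, K (T - r) * U r.toNNReal ω) +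
        c * ∫ r in (0 : ℝ)..T, K (T - r) * Z r.toNNReal ω := by
    rw [← intervalIntegral.integral_const_mul, ← intervalIntegral.integral_const_mul,
      ← intervalIntegral.integral_add (iU.const_mul b) (iZ.const_mul c)]
    exact intervalIntegral.integral_congr fun r _ => by ring
  have e2 : ∫ r in (0 : ℝ)..T, K (T - r) * Z (min r.toNNReal T) ω =
      ∫ r in (0 : ℝ)..T, K (T - r) * Z r.toNNReal ω := by
    refine intervalIntegral.integral_congr fun r hr => ?_
    rw [Set.uIcc_of_le hT0] at hr
    simp only [min_eq_left (Real.toNNReal_le_iff_le_coe.2 hr.2)]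
  have e3 : 0 ≤ ∫ r in (0 : ℝ)..T, K (T - r) * U r.toNNReal ω := by
    refine intervalIntegral.integral_nonneg_of_ae_restrict hT0 ?_
    -- The sign of `K` is assumed only on `(0, T]`, so the point `r = T`, where `K 0` would appear,
    -- is discarded.
    have hne : ∀ᵐ r : ℝ, r ≠ T := measure_eq_zero_iff_ae_notMem.1 (measure_singleton (T : ℝ))
    filter_upwards [ae_restrict_mem measurableSet_Icc, ae_restrict_of_ae hne] with r hr hrT
    have hlt : r < T := lt_of_le_of_ne hr.2 hrT
    have hpos : 0 ≤ K (T - r) := hK0 ⟨T - r, sub_nonneg.2 hr.2⟩ (sub_pos.2 hlt)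
      (sub_le_self (T : ℝ) hr.1)
    exact mul_nonneg hpos (hUnn _ (Real.toNNReal_le_iff_le_coe.2 hr.2))
  rw [Real.norm_of_nonneg (hUnn T le_rfl), heq, e1, e2]
  have := mul_nonpos_of_nonpos_of_nonneg hb e3
  linarith

lemma isContMartWithQuadVar [IsProbabilityMeasure P] (h : IsSolution K g₀ b c T 𝓕 P U Z)
    (hK : IntervalIntegrable K volume 0 T) (hK0 : ∀ t : ℝ≥0, 0 < t → t ≤ T → 0 ≤ K t) (hb : b ≤ 0) :
    IsContMartWithQuadVar 𝓕 P (fun t => Z (min t T)) (fun t => U (min t T)) where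
  martingale := h.Z_martingale
  cont := h.Z_cont.mono fun ω hω => continuous_frozen hω
  zero := by simpa using h.Z_zero
  V_adapted t := (h.U_adapted _ (min_le_right _ _)).mono (𝓕.mono (min_le_left _ _))
  V_cont := h.U_cont.mono fun ω hω => continuous_frozen hω
  V_mono := h.U_mono.mono fun ω hω a b hab =>
    hω (Set.mem_Iic.2 (min_le_right _ _)) (Set.mem_Iic.2 (min_le_right _ _))
      (min_le_min_right _ hab)
  V_zero := by simpa using h.U_zero
  V_integrable t := by
    refine (h.integrable_U hK hK0 hb).mono'
      ((h.U_adapted _ (min_le_right t T)).mono (𝓕.le _)).aestronglyMeasurable ?_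
    filter_upwards [h.U_mono, h.U_zero] with ω hUm hU0
    have hnn : 0 ≤ U (min t T) ω := hU0 ▸ hUm (Set.mem_Iic.2 (zero_le))
      (Set.mem_Iic.2 (min_le_right _ _)) (zero_le (a := min t T))
    rw [Real.norm_of_nonneg hnn]
    exact hUm (Set.mem_Iic.2 (min_le_right _ _)) (Set.mem_Iic.2 le_rfl) (min_le_right _ _)
  quadVar := h.quadVar

end IsSolution

/-- Used to pass between `Z`, `U` and their versions frozen at `T`, to which the martingale results
apply. -/
lemma isItoIntegral_congr {𝓕 : Filtration ℝ≥0 mΩ} {P : Measure Ω} {Z Z' A A' : ℝ≥0 → Ω → ℝ}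
    {H : ℝ → Ω → ℝ} {s : ℝ≥0} (hZ : ∀ r ≤ s, Z r = Z' r) (hA : ∀ r ≤ s, A r = A' r) (I : Ω → ℝ) :
    IsItoIntegral 𝓕 P Z A H s I ↔ IsItoIntegral 𝓕 P Z' A' H s I := by
  have h1 : ∀ ω, stieltjesMeasure (fun u => A u ω) s = stieltjesMeasure (fun u => A' u ω) s :=
    fun ω => stieltjesMeasure_congr fun r hr => by rw [hA r hr]
  have h2 : ∀ S : SimplePredictable 𝓕, S.integral Z s = S.integral Z' s := fun S => by
    ext ω
    unfold SimplePredictable.integral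
    refine Finset.sum_congr rfl fun i _ => ?_
    rw [hZ _ (min_le_right _ _), hZ _ (min_le_right _ _)]
  unfold IsItoIntegral
  simp_rw [h1, h2]

/-! ### Identification of `G` and the dynamics of increments -/

namespace IsSolution

variable {K g₀ : ℝ → ℝ} {b c : ℝ} {T : ℝ≥0} {𝓕 : Filtration ℝ≥0 mΩ} {P : Measure Ω}
  {U Z : ℝ≥0 → Ω → ℝ} {s t : ℝ≥0}

/-- The pathwise version, obtained through integration by parts, of `∫_0^s ∫_s^t K(u - r) du dX_r`
for a path `x` of `X`. -/
def kernelPathIntegral (K : ℝ → ℝ) (s t : ℝ≥0) (x : ℝ≥0 → ℝ) : ℝ :=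
  kernelInt K s t s * x s - ∫ r in (0 : ℝ)..s, x r.toNNReal * kernelDiff K s t r

lemma tendsto_sum_kernelPathIntegral (hK : IntervalIntegrable K volume 0 T) (hst : s ≤ t)
    (htT : t ≤ T) {x : ℝ≥0 → ℝ} (hx : ContinuousOn x (Set.Iic T)) (hx0 : x 0 = 0) :
    Tendsto (fun n => ∑ i ∈ Finset.range (n + 1), kernelInt K s t (gridPoint s n i) *
        (x (gridPoint s n (i + 1)) - x (gridPoint s n i))) atTop
      (𝓝 (kernelPathIntegral K s t x)) :=
  tendsto_sum_grid (intervalIntegrable_kernelDiff hK hst htT le_rfl s.coe_nonneg s.coe_nonneg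
    le_rfl) (fun _ hr => kernelInt_eq hK hst htT hr)
    (hx.mono (Set.Iic_subset_Iic.2 (hst.trans htT))) hx0

/-- The Stieltjes integral and the by-parts expression are limits of the same Riemann sums. -/
lemma integrable_and_integral_kernelInt (hK : IntervalIntegrable K volume 0 T) (hst : s ≤ t)
    (htT : t ≤ T) {x : ℝ≥0 → ℝ} (hx : ContinuousOn x (Set.Iic T)) (hx0 : x 0 = 0)
    (hm : MonotoneOn x (Set.Iic T)) :
    Integrable (kernelInt K s t) (stieltjesMeasure x s) ∧
      ∫ r, kernelInt K s t r ∂(stieltjesMeasure x s) = kernelPathIntegral K s t x := by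
  have hsT := hst.trans htT
  have hmono : Monotone fun r => x (min r T) := fun a b hab =>
    hm (Set.mem_Iic.2 (min_le_right _ _)) (Set.mem_Iic.2 (min_le_right _ _))
      (min_le_min_right _ hab)
  have hcont := continuous_frozen hx
  have hH := continuousOn_kernelInt hK hst htT
  rw [stieltjesMeasure_congr (B := fun r => x (min r T))
    fun r hr => by rw [min_eq_left (hr.trans hsT)]]
  refine ⟨integrable_stieltjesMeasure hmono hcont hH, tendsto_nhds_unique
    (tendsto_sum_grid_integral_stieltjesMeasure hmono hcont hH) ?_⟩
  refine (tendsto_sum_kernelPathIntegral hK hst htT hx hx0).congr fun n =>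
    Finset.sum_congr rfl fun i hi => ?_
  have hi' := Finset.mem_range.1 hi
  rw [min_eq_left ((gridPoint_le hi').trans hsT), min_eq_left ((gridPoint_le hi'.le).trans hsT)]

lemma kernelPathIntegral_lin (hK : IntervalIntegrable K volume 0 T) (hst : s ≤ t)
    (htT : t ≤ T) {x y : ℝ≥0 → ℝ} (hx : ContinuousOn x (Set.Iic T))
    (hy : ContinuousOn y (Set.Iic T)) (hx0 : x 0 = 0) (hy0 : y 0 = 0) (b c : ℝ) :
    kernelPathIntegral K s t (fun r => b * x r + c * y r) =
      b * kernelPathIntegral K s t x + c * kernelPathIntegral K s t y := by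
  refine tendsto_nhds_unique (tendsto_sum_kernelPathIntegral hK hst htT
    ((hx.const_mul b).add (hy.const_mul c)) (by simp [hx0, hy0]))
    ((((tendsto_sum_kernelPathIntegral hK hst htT hx hx0).const_mul b).add
      ((tendsto_sum_kernelPathIntegral hK hst htT hy hy0).const_mul c)).congr fun n => ?_)
  rw [Finset.mul_sum, Finset.mul_sum, ← Finset.sum_add_distrib]
  exact Finset.sum_congr rfl fun i _ => by ring

variable [IsProbabilityMeasure P]

lemma exists_unique_isItoIntegral (h : IsSolution K g₀ b c T 𝓕 P U Z)
    (hK : IntervalIntegrable K volume 0 T) (hK0 : ∀ t : ℝ≥0, 0 < t → t ≤ T → 0 ≤ K t) (hb : b ≤ 0)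
    (hst : s ≤ t) (htT : t ≤ T) :
    IsItoIntegral 𝓕 P Z U (fun r _ => kernelInt K s t r) s
        (fun ω => kernelPathIntegral K s t fun u => Z u ω) ∧
      ∀ J, IsItoIntegral 𝓕 P Z U (fun r _ => kernelInt K s t r) s J →
        J =ᵐ[P] fun ω => kernelPathIntegral K s t fun u => Z u ω := by
  have hsT := hst.trans htT
  have hM := h.isContMartWithQuadVar hK hK0 hb
  have hH := continuousOn_kernelInt hK hst htT
  have hI : ∀ᵐ ω ∂P, Tendsto (fun n => (gridStep 𝓕 (kernelInt K s t) s n).integral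
      (fun t => Z (min t T)) s ω) atTop (𝓝 (kernelPathIntegral K s t fun u => Z u ω)) := by
    filter_upwards [h.Z_cont, h.Z_zero] with ω hc h0
    refine (tendsto_sum_kernelPathIntegral hK hst htT hc h0).congr fun n => ?_
    rw [gridStep_integral]
    refine Finset.sum_congr rfl fun i hi => ?_
    have hi' := Finset.mem_range.1 hi
    rw [min_eq_left ((gridPoint_le hi').trans hsT), min_eq_left ((gridPoint_le hi'.le).trans hsT)]
  have hcongr := isItoIntegral_congr (𝓕 := 𝓕) (P := P) (H := fun r _ => kernelInt K s t r)
    (s := s) (Z := Z) (Z' := fun t => Z (min t T)) (A := U) (A' := fun t => U (min t T))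
    (fun r hr => by rw [min_eq_left (hr.trans hsT)])
    (fun r hr => by rw [min_eq_left (hr.trans hsT)])
  exact ⟨(hcongr _).2 (hM.isItoIntegral_of_tendsto hH hI),
    fun J hJ => hM.isItoIntegral_unique hH hI ((hcongr J).1 hJ)⟩

/-- `itoIntegral` is an arbitrary choice among versions; uniqueness identifies it almost surely with
the pathwise expression, which is linear in the path and so combines the `U` and `Z` parts. -/
lemma G_ae_eq (h : IsSolution K g₀ b c T 𝓕 P U Z)
    (hK : IntervalIntegrable K volume 0 T) (hK0 : ∀ t : ℝ≥0, 0 < t → t ≤ T → 0 ≤ K t) (hb : b ≤ 0)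
    (hst : s ≤ t) (htT : t ≤ T) :
    G K g₀ b c 𝓕 P U Z s t =ᵐ[P] fun ω => (∫ u in (s : ℝ)..t, g₀ u) +
      kernelPathIntegral K s t fun u => b * U u ω + c * Z u ω := by
  obtain ⟨hex, huniq⟩ := h.exists_unique_isItoIntegral hK hK0 hb hst htT
  have hE : ∃ I, IsItoIntegral 𝓕 P Z U (fun r _ => kernelInt K s t r) s I := ⟨_, hex⟩
  have hito : itoIntegral 𝓕 P Z U (fun r _ => kernelInt K s t r) s =ᵐ[P]
      fun ω => kernelPathIntegral K s t fun u => Z u ω := by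
    unfold itoIntegral
    rw [dif_pos hE]
    exact huniq _ hE.choose_spec
  filter_upwards [hito, h.U_cont, h.Z_cont, h.U_zero, h.Z_zero, h.U_mono]
    with ω hω hUc hZc hU0 hZ0 hUm
  unfold G
  rw [hω, (integrable_and_integral_kernelInt hK hst htT hUc hU0 hUm).2,
    kernelPathIntegral_lin hK hst htT hUc hZc hU0 hZ0]

lemma exists_stronglyMeasurable_ae_eq_G (h : IsSolution K g₀ b c T 𝓕 P U Z)
    (hK : IntervalIntegrable K volume 0 T) (hK0 : ∀ t : ℝ≥0, 0 < t → t ≤ T → 0 ≤ K t) (hb : b ≤ 0)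
    (hst : s ≤ t) (htT : t ≤ T) :
    ∃ f, StronglyMeasurable[𝓕 s] f ∧ G K g₀ b c 𝓕 P U Z s t =ᵐ[P] f := by
  have hsT := hst.trans htT
  let D : ℕ → Ω → ℝ := fun n ω => (∫ u in (s : ℝ)..t, g₀ u) +
    ∑ i ∈ Finset.range (n + 1), kernelInt K s t (gridPoint s n i) *
      ((b * U (gridPoint s n (i + 1)) ω + c * Z (gridPoint s n (i + 1)) ω) -
        (b * U (gridPoint s n i) ω + c * Z (gridPoint s n i) ω))
  have hU : ∀ r ≤ s, StronglyMeasurable[𝓕 s] (U r) := fun r hr =>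
    (h.U_adapted r (hr.trans hsT)).mono (𝓕.mono hr)
  have hZ : ∀ r ≤ s, StronglyMeasurable[𝓕 s] (Z r) := fun r hr => by
    have := h.Z_martingale.stronglyMeasurable r
    simp only [min_eq_left (hr.trans hsT)] at this
    exact this.mono (𝓕.mono hr)
  have hX : ∀ r ≤ s, StronglyMeasurable[𝓕 s] fun ω => b * U r ω + c * Z r ω := fun r hr =>
    ((hU r hr).const_mul b).add ((hZ r hr).const_mul c)
  have hD : ∀ n, StronglyMeasurable[𝓕 s] (D n) := fun n =>
    stronglyMeasurable_const.add (Finset.stronglyMeasurable_fun_sum _ fun i hi =>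
      ((hX _ (gridPoint_le (Finset.mem_range.1 hi))).sub
        (hX _ (gridPoint_le (Finset.mem_range.1 hi).le))).const_mul _)
  -- `limUnder` is `𝓕 s`-measurable on all of `Ω`, also where the sums diverge, so the exceptional
  -- null set need not belong to `𝓕 s`.
  refine ⟨fun ω => limUnder atTop fun n => D n ω, 
    @StronglyMeasurable.limUnder _ _ _ (𝓕 s) _ _ _ _ _ _ _ hD, ?_⟩
  filter_upwards [h.G_ae_eq hK hK0 hb hst htT, h.U_cont, h.Z_cont, h.U_zero, h.Z_zero]
    with ω hG hUc hZc hU0 hZ0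
  rw [hG]
  refine (Tendsto.limUnder_eq (tendsto_const_nhds.add ?_)).symm
  exact tendsto_sum_kernelPathIntegral hK hst htT
    (x := fun u => b * U u ω + c * Z u ω) ((hUc.const_mul b).add (hZc.const_mul c))
    (by simp [hU0, hZ0])

/-- The dynamics of the increments of a solution. -/
lemma ae_incr_eq (h : IsSolution K g₀ b c T 𝓕 P U Z)
    (hK : IntervalIntegrable K volume 0 T) (hK0 : ∀ t : ℝ≥0, 0 < t → t ≤ T → 0 ≤ K t)
    (hg : IntervalIntegrable g₀ volume 0 T) (hb : b ≤ 0) (hst : s ≤ t) (htT : t ≤ T) :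
    ∀ᵐ ω ∂P,
      IntervalIntegrable (fun r : ℝ => K (t - r) *
        (b * incr U s r.toNNReal ω + c * incr Z s r.toNNReal ω)) volume s t ∧
      incr U s t ω = G K g₀ b c 𝓕 P U Z s t ω +
        ∫ r in (s : ℝ)..t, K (t - r) *
          (b * incr U s r.toNNReal ω + c * incr Z s r.toNNReal ω) := by
  have hst' : (s : ℝ) ≤ t := by exact_mod_cast hst
  have htT' : (t : ℝ) ≤ T := by exact_mod_cast htT
  filter_upwards [h.G_ae_eq hK hK0 hb hst htT, h.U_cont, h.Z_cont, h.equation t htT,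
    h.equation s (hst.trans htT)] with ω hG hUc hZc ht hs
  have hincr : (fun r : ℝ => K (t - r) * (b * incr U s r.toNNReal ω + c * incr Z s r.toNNReal ω)) =
      fun r : ℝ => K (t - r) * ((b * U r.toNNReal ω + c * Z r.toNNReal ω) -
        (b * U s ω + c * Z s ω)) := by
    ext r; simp only [incr]; ring
  obtain ⟨h1, h2⟩ := integral_kernel_split hK hst htT (x := fun u => b * U u ω + c * Z u ω)
    ((hUc.const_mul b).add (hZc.const_mul c))
  rw [hincr]
  refine ⟨h1, ?_⟩
  have hg0 := intervalIntegral.integral_add_adjacent_intervals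
    (intervalIntegrable_sub hg le_rfl T.coe_nonneg s.coe_nonneg (hst'.trans htT'))
    (intervalIntegrable_sub hg s.coe_nonneg (hst'.trans htT') t.coe_nonneg htT')
  rw [hG, incr, kernelPathIntegral]
  linarith

end IsSolution

end Volterra

end

theorem mainTheorem6 {Ω : Type*} {mΩ : MeasurableSpace Ω} (P : Measure Ω) [IsProbabilityMeasure P]
    (𝓕 : Filtration ℝ≥0 mΩ) (T : ℝ≥0) (K g₀ : ℝ → ℝ) (b c : ℝ) (U Z : ℝ≥0 → Ω → ℝ)
    (hK : IntervalIntegrable K volume 0 T) (hK_nonneg : ∀ t, 0 < t → t ≤ T → 0 ≤ K t)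
    (hg : IntervalIntegrable g₀ volume 0 T) (hg_nonneg : ∀ t, 0 < t → t ≤ T → 0 ≤ g₀ t)
    (hb : b ≤ 0) (hc : 0 ≤ c)
    (hUZ : Volterra.IsSolution K g₀ b c T 𝓕 P U Z)
    (s t : ℝ≥0) (hst : s ≤ t) (htT : t ≤ T) :
    -- the integrals that define `G_s(t)` exist, the stochastic one uniquely up to null sets
    (∀ᵐ ω ∂P, Integrable (Volterra.kernelInt K s t)
      (Volterra.stieltjesMeasure (fun u => U u ω) s)) ∧
    (∃ I, Volterra.IsItoIntegral 𝓕 P Z U (fun r _ => Volterra.kernelInt K s t r) s I ∧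
      ∀ J, Volterra.IsItoIntegral 𝓕 P Z U (fun r _ => Volterra.kernelInt K s t r) s J →
        J =ᵐ[P] I) ∧
    -- `G_s(t)` is `𝓕_s`-measurable (up to a null set if `𝓕_s` is not complete)
    AEStronglyMeasurable[𝓕 s] (Volterra.G K g₀ b c 𝓕 P U Z s t) P ∧
    ((∀ N : Set Ω, P N = 0 → MeasurableSet[𝓕 s] N) →
      Measurable[𝓕 s] (Volterra.G K g₀ b c 𝓕 P U Z s t)) ∧
    -- the dynamics of the increments
    ∀ᵐ ω ∂P,
      IntervalIntegrable (fun r : ℝ => K (t - r) *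
        (b * Volterra.incr U s r.toNNReal ω + c * Volterra.incr Z s r.toNNReal ω)) volume s t ∧
      Volterra.incr U s t ω = Volterra.G K g₀ b c 𝓕 P U Z s t ω +
        ∫ r in (s : ℝ)..t, K (t - r) *
          (b * Volterra.incr U s r.toNNReal ω + c * Volterra.incr Z s r.toNNReal ω) := by
  obtain ⟨hI, hJ⟩ := hUZ.exists_unique_isItoIntegral hK hK_nonneg hb hst htT
  obtain ⟨f, hf, hGf⟩ := hUZ.exists_stronglyMeasurable_ae_eq_G hK hK_nonneg hb hst htT
  refine ⟨?_, ⟨_, hI, hJ⟩, ⟨f, hf, hGf⟩, fun hN =>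
    Volterra.measurable_of_ae_eq_of_complete hN hf.measurable hGf,
    hUZ.ae_incr_eq hK hK_nonneg hg hb hst htT⟩
  filter_upwards [hUZ.U_cont, hUZ.U_zero, hUZ.U_mono] with ω hc h0 hm
  exact (Volterra.IsSolution.integrable_and_integral_kernelInt hK hst htT hc h0 hm).1
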